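/- Let $G=\mathrm{SL}_2(\mathbb R)$, $\Gamma=\mathrm{SL}_2(\mathbb Z)$, $X=\Gamma\backslash G$, $a=\begin{pmatrix}e^{1/2}&0\\0&e^{-1/2}\end{pmatrix}$, and let $T:X\to X$, $T(x)=xa$, be the time-one map of the geodesic flow. The height of $x=\Gamma g\in X$ is $$\mathrm{ht}(x)=\Bigl(\min_{v\in\mathbb Z^2\setminus\{0\}}\|vg\|\Bigr)^{-1}$$ with the Euclidean norm $\|\cdot\|$; put $X_{<M}=\{x\in X:\mathrm{ht}(x)<M\}$ and $X_{\ge M}=\{x\in X:\mathrm{ht}(x)\ge M\}$. Given a left-invariant Riemannian metric on $G$ and $\eta>0$, let $B_\eta$ be the open ball of radius $\eta$ about the identity of $G$. A Bowen $N$-ball is a set $xB_N$ with $x\in X$, where $$B_N=\bigcap_{n=-N}^{N}a^{-n}B_\eta a^{n}.$$ For $M>0$, an integer $N\ge1$ and a set $V$ of integers in $[-N,N]$, let $$Z(V)=\bigl\{x\in T^{N}X_{<M}\cap T^{-N}X_{<M}:\ \text{for all integers } n\in[-N,N],\ T^n(x)\in X_{\ge M}\Leftrightarrow n\in V\bigr\}.$$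 There is an absolute constant $M_0>1$ such that the following holds for every fixed height $M\ge M_0$. 1. For every left-invariant Riemannian metric on $G$ and every $\eta>0$ there is a constant $C>0$ (depending only on $M$, the metric and $\eta$) such that for every integer $N\ge1$ and every $V\subset[-N,N]$ the set $Z(V)$ can be covered by at most $C\,e^{2N-\frac12|V|}$ Bowen $N$-balls. 2. There is a constant $C>0$ (depending only on $M$) such that for every integer $N\ge1$ the set $Z(V)$ is nonempty for at most $C\,e^{\frac{2\log\log M}{\log M}N}$ different sets $V\subset[-N,N]$. -/

import Mathlib

open scoped MatrixGroups

namespace ModularFlow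

noncomputable section

/-- The lattice `SL(2,ℤ)` inside `SL(2,ℝ)`. -/
def Gamma : Subgroup SL(2, ℝ) :=
  (Matrix.SpecialLinearGroup.map (n := Fin 2) (Int.castRingHom ℝ)).range

/-- The space `X = SL(2,ℤ) \ SL(2,ℝ)` of cosets `Γ g`. -/
def X : Type := Quotient (QuotientGroup.rightRel Gamma)

/-- The coset `Γ g`. -/
def X.mk (g : SL(2, ℝ)) : X := Quotient.mk (QuotientGroup.rightRel Gamma) g

/-- Right translation `(Γ g, h) ↦ Γ g h`. -/
def X.rmul (x : X) (h : SL(2, ℝ)) : X :=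
  Quotient.liftOn x (fun g => X.mk (g * h)) (by
    intro g₁ g₂ h12
    refine Quotient.sound ?_
    have h12' : g₂ * g₁⁻¹ ∈ Gamma := QuotientGroup.rightRel_apply.mp h12
    refine QuotientGroup.rightRel_apply.mpr ?_
    simpa [mul_assoc] using h12')

theorem X.rmul_mk (g h : SL(2, ℝ)) : (X.mk g).rmul h = X.mk (g * h) := rfl

theorem X.rmul_rmul (x : X) (g h : SL(2, ℝ)) : (x.rmul g).rmul h = x.rmul (g * h) := by
  induction x using Quotient.inductionOn with
  | h k => exact congrArg X.mk (mul_assoc k g h)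

theorem X.rmul_one (x : X) : x.rmul 1 = x := by
  induction x using Quotient.inductionOn with
  | h k => exact congrArg X.mk (mul_one k)

/-- The set of Euclidean norms `‖v g‖` of the nonzero vectors of the lattice `ℤ² g`
(`v` is a row vector). -/
def latticeNorms (g : SL(2, ℝ)) : Set ℝ :=
  {r | ∃ v : Fin 2 → ℤ, v ≠ 0 ∧
    r = ‖WithLp.toLp 2 (Matrix.vecMul (fun i => (v i : ℝ)) (g : Matrix (Fin 2) (Fin 2) ℝ))‖}

theorem latticeNorms_gamma_subset (γ : SL(2, ℤ)) (g : SL(2, ℝ)) :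
    latticeNorms (Matrix.SpecialLinearGroup.map (Int.castRingHom ℝ) γ * g) ⊆ latticeNorms g := by
  rintro r ⟨v, hv, rfl⟩
  refine ⟨Matrix.vecMul v (γ : Matrix (Fin 2) (Fin 2) ℤ), ?_, ?_⟩
  · intro h0
    apply hv
    have h1 := congrArg
      (fun w => Matrix.vecMul w ((γ⁻¹ : SL(2, ℤ)) : Matrix (Fin 2) (Fin 2) ℤ)) h0
    simp only [Matrix.vecMul_vecMul, Matrix.zero_vecMul] at h1
    rw [← Matrix.SpecialLinearGroup.coe_mul, mul_inv_cancel] at h1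
    simpa using h1
  · rw [Matrix.SpecialLinearGroup.coe_mul, ← Matrix.vecMul_vecMul]
    congr 3
    funext j
    simp [Matrix.vecMul, dotProduct, Fin.sum_univ_two]

theorem latticeNorms_gamma (γ : SL(2, ℤ)) (g : SL(2, ℝ)) :
    latticeNorms (Matrix.SpecialLinearGroup.map (Int.castRingHom ℝ) γ * g) = latticeNorms g := by
  refine Set.Subset.antisymm (latticeNorms_gamma_subset γ g) ?_
  have h := latticeNorms_gamma_subset γ⁻¹
    (Matrix.SpecialLinearGroup.map (Int.castRingHom ℝ) γ * g)
  rwa [← mul_assoc, ← map_mul, inv_mul_cancel, map_one, one_mul] at h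

/-- The height of `Γ g`: the inverse of the length of a shortest nonzero vector of the lattice
`ℤ² g`, which has covolume `1` because `det g = 1`. -/
def ht (x : X) : ℝ :=
  Quotient.liftOn x (fun g => (sInf (latticeNorms g))⁻¹) (by
    intro g₁ g₂ h12
    obtain ⟨γ, hγ⟩ : g₂ * g₁⁻¹ ∈ Gamma := QuotientGroup.rightRel_apply.mp h12
    have h2 : g₂ = Matrix.SpecialLinearGroup.map (Int.castRingHom ℝ) γ * g₁ := by
      rw [hγ, inv_mul_cancel_right]
    show (sInf (latticeNorms g₁))⁻¹ = (sInf (latticeNorms g₂))⁻¹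
    rw [h2, latticeNorms_gamma])

/-- The part `X_{< M}` of `X` below height `M`. -/
def below (M : ℝ) : Set X := {x | ht x < M}

/-- The part `X_{≥ M}` of `X` of height at least `M`. -/
def above (M : ℝ) : Set X := {x | M ≤ ht x}

/-- The matrix `a = diag(e^{1/2}, e^{-1/2})`. -/
def a : SL(2, ℝ) :=
  ⟨!![Real.exp (1 / 2), 0; 0, Real.exp (-(1 / 2))], by
    rw [Matrix.det_fin_two_of, ← Real.exp_add]; simp⟩

/-- The time-one map `T x = x a` of the geodesic flow, as a bijection of `X`. -/
def T : Equiv.Perm X where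
  toFun x := x.rmul a
  invFun x := x.rmul a⁻¹
  left_inv x := by
    show (x.rmul a).rmul a⁻¹ = x
    rw [X.rmul_rmul, mul_inv_cancel, X.rmul_one]
  right_inv x := by
    show (x.rmul a⁻¹).rmul a = x
    rw [X.rmul_rmul, inv_mul_cancel, X.rmul_one]

/-- `B` restricts to an inner product on the Lie algebra `sl(2,ℝ)` of trace-zero matrices. -/
def IsInnerProductOnSl2 (B : LinearMap.BilinForm ℝ (Matrix (Fin 2) (Fin 2) ℝ)) : Prop :=
  (∀ u v : Matrix (Fin 2) (Fin 2) ℝ, u.trace = 0 → v.trace = 0 → B u v = B v u) ∧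
  (∀ u : Matrix (Fin 2) (Fin 2) ℝ, u.trace = 0 → u ≠ 0 → 0 < B u u)

/-- The velocity `c'(t)` of a curve in `SL(2,ℝ)`, taken entrywise. -/
def velocity (c : ℝ → SL(2, ℝ)) (t : ℝ) : Matrix (Fin 2) (Fin 2) ℝ :=
  Matrix.of fun i j => deriv (fun s => (c s : Matrix (Fin 2) (Fin 2) ℝ) i j) t

/-- `c(t)⁻¹ c'(t)`, the velocity translated back to the identity by left translation. -/
def leftVelocity (c : ℝ → SL(2, ℝ)) (t : ℝ) : Matrix (Fin 2) (Fin 2) ℝ :=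
  (((c t)⁻¹ : SL(2, ℝ)) : Matrix (Fin 2) (Fin 2) ℝ) * velocity c t

/-- The length of `c` on `[0,1]` for the left-invariant Riemannian metric that is given by `B`
on `sl(2,ℝ)`. -/
def curveLength (B : LinearMap.BilinForm ℝ (Matrix (Fin 2) (Fin 2) ℝ)) (c : ℝ → SL(2, ℝ)) : ℝ :=
  ∫ t in (0 : ℝ)..1, Real.sqrt (B (leftVelocity c t) (leftVelocity c t))

/-- The distance on `SL(2,ℝ)` for the left-invariant Riemannian metric given by `B`: the infimum
of the lengths of the `C¹` curves that join the two points. -/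
def riemDist (B : LinearMap.BilinForm ℝ (Matrix (Fin 2) (Fin 2) ℝ)) (g h : SL(2, ℝ)) : ℝ :=
  sInf {l | ∃ c : ℝ → SL(2, ℝ),
    (∀ i j, ContDiff ℝ 1 (fun t => (c t : Matrix (Fin 2) (Fin 2) ℝ) i j)) ∧
    c 0 = g ∧ c 1 = h ∧ l = curveLength B c}

/-- The open ball of radius `η` about the identity of `SL(2,ℝ)`. -/
def groupBall (B : LinearMap.BilinForm ℝ (Matrix (Fin 2) (Fin 2) ℝ)) (η : ℝ) : Set SL(2, ℝ) :=
  {g | riemDist B 1 g < η}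

/-- `B_N = ⋂_{n = -N}^{N} a^{-n} B_η a^n`. -/
def bowenSet (B : LinearMap.BilinForm ℝ (Matrix (Fin 2) (Fin 2) ℝ)) (η : ℝ) (N : ℕ) :
    Set SL(2, ℝ) :=
  ⋂ n ∈ Set.Icc (-(N : ℤ)) (N : ℤ), (fun g => a ^ (-n) * g * a ^ n) '' groupBall B η

/-- The Bowen `N`-ball `x B_N`. -/
def bowenBall (B : LinearMap.BilinForm ℝ (Matrix (Fin 2) (Fin 2) ℝ)) (η : ℝ) (N : ℕ) (x : X) :
    Set X :=
  (fun g => x.rmul g) '' bowenSet B η N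

/-- `Z(V)`: the points of `T^N X_{< M} ∩ T^{-N} X_{< M}` whose orbit is in `X_{≥ M}` exactly at
those times `n ∈ [-N, N]` that belong to `V`. -/
def Z (M : ℝ) (N : ℕ) (V : Finset ℤ) : Set X :=
  {x | x ∈ ((T ^ (N : ℤ)) '' below M) ∩ ((T ^ (-(N : ℤ))) '' below M) ∧
    ∀ n ∈ Set.Icc (-(N : ℤ)) (N : ℤ), ((T ^ n) x ∈ above M ↔ n ∈ V)}

end

end ModularFlow

/-!
A point of `X` is a unimodular lattice `ℤ² g`, and it has height at least `M` exactly when the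
lattice has a primitive vector of length at most `1 / M` (`le_ht_iff_isShortAt`). Two primitive
vectors that are not `±` each other have lengths with product at least one. Hence a single vector
is responsible for each excursion to height `≥ M` (`exists_sqLen_le_on_Icc`), and two excursions
are separated by a time at least `4 log M`, needed for one vector to become long and for the other
to become short (`pow_four_le_exp_of_gap`).

*Covering.* The starting point at time `-N` lies in a compact part of `X`, so up to finitely many
choices it is `g * lowerMat r * upperMat l b` with `g` fixed and `r, l, b` small
(`exists_bounded_representative`, `exists_finset_net`). Only the displacement `r` is expanded by
the flow, so a Bowen `N`-ball corresponds to an interval of length about `e^{-2N}` in `r`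
(`exists_mem_bowenBall`). Let the first excursion last from `p` to `q`, times being counted from
the starting point, and let `(x, y)` be the vector of `ℤ² g` responsible for it. Then `|y|` is
about `e^{p/2} / M` and `r` is within a constant times `e^{-(p+q)/2}` of the slope `-x / y`
(`coord_bounds_of_excursion`). Such slopes are `M² / (2 e^p)`-separated, as for Farey fractions
(`le_abs_slope_sub`), so an interval of radius `ρ` is replaced by about `ρ e^p / M²` intervals of
radius `4 e^{-(p+q)/2}`: the total length shrinks by a factor `e^{-(q-p)/2} / M²` up to an
absolute constant, and the factor `M⁻²` absorbs this constant. Recursion over the excursions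
(`exists_cover_of_pattern`) gives the factor `e^{-|V|/2}` without any loss per excursion.

*Counting.* A set `V` that occurs is determined by the starts and ends of its runs. Both are
`4 log M`-separated, so there are at most `N / log M + 4` of them in total
(`card_runBoundary_le`), and the subsets of `[-N, N]` with so few elements are counted with the
weights `z ^ card`, `z = 1 / (2 log M)` (`ncard_patterns_le`).
-/

namespace ModularFlow

/-! ### Lengths of lattice vectors along the flow -/

/-- First coordinate of the lattice vector `v g`. -/
noncomputable def coordX (g : SL(2, ℝ)) (v : ℤ × ℤ) : ℝ := v.1 * g 0 0 + v.2 * g 1 0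

/-- Second coordinate of the lattice vector `v g`. -/
noncomputable def coordY (g : SL(2, ℝ)) (v : ℤ × ℤ) : ℝ := v.1 * g 0 1 + v.2 * g 1 1

/-- Squared length of `v g a ^ t`: the first coordinate of `v g` is multiplied by `e^{t/2}` and
the second one by `e^{-t/2}`. -/
noncomputable def sqLen (g : SL(2, ℝ)) (v : ℤ × ℤ) (t : ℤ) : ℝ :=
  coordX g v ^ 2 * Real.exp t + coordY g v ^ 2 * Real.exp (-t)

/-- The lattice `ℤ² g a ^ t` has a primitive vector of length at most `1 / M`. Restricting to
primitive vectors makes the vector unique up to sign. -/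
def IsShortAt (M : ℝ) (g : SL(2, ℝ)) (t : ℤ) : Prop :=
  ∃ v : ℤ × ℤ, IsCoprime v.1 v.2 ∧ sqLen g v t ≤ 1 / M ^ 2

/-- On the times in `[m, n]`, the short lattice vectors occur exactly at the times in `V`. -/
def HasPattern (M : ℝ) (g : SL(2, ℝ)) (m n : ℤ) (V : Finset ℤ) : Prop :=
  ∀ t ∈ Set.Icc m n, IsShortAt M g t ↔ t ∈ V

theorem sqLen_nonneg (g : SL(2, ℝ)) (v : ℤ × ℤ) (t : ℤ) : 0 ≤ sqLen g v t := by
  unfold sqLen; positivity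

theorem coord_det (g : SL(2, ℝ)) (v w : ℤ × ℤ) :
    coordX g v * coordY g w - coordX g w * coordY g v = v.1 * w.2 - v.2 * w.1 := by
  have h := g.det_coe
  rw [Matrix.det_fin_two] at h
  unfold coordX coordY
  linear_combination ((v.1 : ℝ) * w.2 - v.2 * w.1) * h

theorem coord_det_sq_le (g : SL(2, ℝ)) (v w : ℤ × ℤ) (t : ℤ) :
    (coordX g v * coordY g w - coordX g w * coordY g v) ^ 2 ≤ sqLen g v t * sqLen g w t := by
  have h : Real.exp t * Real.exp (-(t : ℝ)) = 1 := by rw [← Real.exp_add]; simp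
  unfold sqLen
  have h1 : 0 ≤ (coordX g v * coordX g w * Real.exp t
      + coordY g v * coordY g w * Real.exp (-(t : ℝ))) ^ 2 := sq_nonneg _
  generalize Real.exp (t : ℝ) = u at *
  generalize Real.exp (-(t : ℝ)) = w' at *
  have h2 : (coordX g v ^ 2 * u + coordY g v ^ 2 * w') * (coordX g w ^ 2 * u + coordY g w ^ 2 * w')
    - (coordX g v * coordX g w * u + coordY g v * coordY g w * w') ^ 2
    = (u * w') * (coordX g v * coordY g w - coordX g w * coordY g v) ^ 2 := by ring
  rw [h] at h2
  linarith

theorem eq_or_eq_neg_of_isCoprime_of_det_eq_zero {v w : ℤ × ℤ} (hv : IsCoprime v.1 v.2)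
    (hw : IsCoprime w.1 w.2) (h : v.1 * w.2 - v.2 * w.1 = 0) : w = v ∨ w = -v := by
  obtain ⟨a, b⟩ := v
  obtain ⟨c, d⟩ := w
  obtain ⟨s, t, hst⟩ := hv
  obtain ⟨s', t', hst'⟩ := hw
  simp only at *
  -- `w = k v` with `k = s c + t d`, and the inverse factor is `s' a + t' b`
  have hc : c = (s * c + t * d) * a := by linear_combination (-c) * hst + (-t) * h
  have hd : d = (s * c + t * d) * b := by linear_combination (-d) * hst + s * h
  have hu : (s * c + t * d) * (s' * a + t' * b) = 1 := by
    linear_combination hst' - s' * hc - t' * hd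
  rcases Int.isUnit_iff.mp (IsUnit.of_mul_eq_one _ hu) with h1 | h1
  · left; rw [h1] at hc hd; simp_all
  · right; rw [h1] at hc hd; simp only [Prod.neg_mk, Prod.mk.injEq]; constructor <;> linarith

theorem sqLen_neg (g : SL(2, ℝ)) (v : ℤ × ℤ) (t : ℤ) : sqLen g (-v) t = sqLen g v t := by
  simp only [sqLen, coordX, coordY, Prod.fst_neg, Prod.snd_neg, Int.cast_neg]; ring

/-- Lattices of covolume one: a primitive vector `w` that is not `± v` satisfies
`‖v‖ ‖w‖ ≥ 1` at every time. -/
theorem sqLen_eq_of_mul_lt_one {g : SL(2, ℝ)} {v w : ℤ × ℤ} (hv : IsCoprime v.1 v.2)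
    (hw : IsCoprime w.1 w.2) {t : ℤ} (h : sqLen g v t * sqLen g w t < 1) (s : ℤ) :
    sqLen g w s = sqLen g v s := by
  have h0 : v.1 * w.2 - v.2 * w.1 = 0 := by
    by_contra hne
    have h1 : (1 : ℝ) ≤ ((v.1 : ℝ) * w.2 - v.2 * w.1) ^ 2 := by
      have : (1 : ℤ) ≤ (v.1 * w.2 - v.2 * w.1) ^ 2 := sq_pos_iff.mpr hne
      exact_mod_cast this
    have := coord_det_sq_le g v w t
    rw [coord_det] at this
    linarith
  rcases eq_or_eq_neg_of_isCoprime_of_det_eq_zero hv hw h0 with rfl | rfl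
  · rfl
  · exact sqLen_neg g v s

theorem sqLen_le_exp_mul (g : SL(2, ℝ)) (v : ℤ × ℤ) {s t : ℤ} (hst : s ≤ t) :
    sqLen g v t ≤ Real.exp (t - s) * sqLen g v s := by
  have h : (s : ℝ) ≤ t := by exact_mod_cast hst
  unfold sqLen
  rw [mul_add, mul_left_comm, mul_left_comm (Real.exp _), ← Real.exp_add, ← Real.exp_add]
  gcongr <;> linarith

/-- The squared length of a fixed vector is a convex function of time, so once it has increased
it never decreases again. -/
theorem sqLen_mono_of_lt {g : SL(2, ℝ)} {v : ℤ × ℤ} {q p : ℤ}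
    (h : sqLen g v q < sqLen g v (q + 1)) (hp : q + 1 ≤ p) : sqLen g v (q + 1) ≤ sqLen g v p := by
  have hp' : ((q + 1 : ℤ) : ℝ) ≤ p := by exact_mod_cast hp
  have e1 : Real.exp (p : ℝ) = Real.exp ((q + 1 : ℤ) : ℝ) * Real.exp (p - (q + 1 : ℤ)) := by
    rw [← Real.exp_add]; ring_nf
  have e2 : Real.exp (-(p : ℝ)) = Real.exp (-((q + 1 : ℤ) : ℝ)) / Real.exp (p - (q + 1 : ℤ)) := by
    rw [← Real.exp_sub]; ring_nf
  have e3 : Real.exp (q : ℝ) = Real.exp ((q + 1 : ℤ) : ℝ) / Real.exp 1 := by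
    rw [← Real.exp_sub]; push_cast; ring_nf
  have e4 : Real.exp (-(q : ℝ)) = Real.exp (-((q + 1 : ℤ) : ℝ)) * Real.exp 1 := by
    rw [← Real.exp_add]; push_cast; ring_nf
  unfold sqLen at *
  rw [e1, e2]
  rw [e3, e4] at h
  have hu : 1 ≤ Real.exp ((p : ℝ) - (q + 1 : ℤ)) := Real.one_le_exp (by linarith)
  have he : 1 < Real.exp 1 := by simp
  have hA : 0 ≤ coordX g v ^ 2 * Real.exp ((q + 1 : ℤ) : ℝ) := by positivity
  have hB : 0 ≤ coordY g v ^ 2 * Real.exp (-((q + 1 : ℤ) : ℝ)) := by positivity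
  rw [← mul_div_assoc, ← mul_assoc] at h
  rw [← mul_assoc, ← mul_div_assoc]
  generalize coordX g v ^ 2 * Real.exp ((q + 1 : ℤ) : ℝ) = A at *
  generalize coordY g v ^ 2 * Real.exp (-((q + 1 : ℤ) : ℝ)) = B at *
  generalize Real.exp ((p : ℝ) - (q + 1 : ℤ)) = u at *
  generalize Real.exp 1 = e at *
  have hAB : B ≤ A := by
    have h' : A + B * e * e < (A + B) * e := by
      have := mul_lt_mul_of_pos_right h (by linarith : 0 < e)
      rw [add_mul, div_mul_cancel₀ _ (by linarith)] at this
      linarith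
    have : (e - 1) * (B * e) < (e - 1) * A := by linarith
    have := lt_of_mul_lt_mul_left this (by linarith)
    nlinarith
  have h0 : B / u = B - (u - 1) * (B / u) := by field_simp; ring
  have h1 : B / u ≤ A := (div_le_self hB hu).trans hAB
  nlinarith [mul_le_mul_of_nonneg_left h1 (by linarith : 0 ≤ u - 1)]

/-! ### Excursions -/

/-- Time between two excursions: if an excursion ends at time `q`, any later excursion starts
after a time at least `4 log M`, because the two vectors responsible span a sublattice of
covolume at least one. -/
theorem pow_four_le_exp_of_gap {M : ℝ} (hM : 1 < M) {g : SL(2, ℝ)} {q p : ℤ}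
    (hq : IsShortAt M g q) (hq' : ¬ IsShortAt M g (q + 1)) (hp : IsShortAt M g p) (hqp : q < p) :
    M ^ 4 ≤ Real.exp (p - q) := by
  obtain ⟨v, hv, hvq⟩ := hq
  obtain ⟨w, hw, hwp⟩ := hp
  have hv' : 1 / M ^ 2 < sqLen g v (q + 1) := by
    by_contra hcon
    exact hq' ⟨v, hv, not_lt.mp hcon⟩
  have hvp : 1 / M ^ 2 < sqLen g v p :=
    hv'.trans_le (sqLen_mono_of_lt (hvq.trans_lt hv') hqp)
  have h1 : 1 ≤ sqLen g v p * sqLen g w p := by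
    by_contra hcon
    have := sqLen_eq_of_mul_lt_one hv hw (not_le.mp hcon) p
    linarith
  have h2 : sqLen g v p ≤ Real.exp (p - q) * (1 / M ^ 2) :=
    (sqLen_le_exp_mul g v hqp.le).trans (by gcongr)
  have h3 : 1 ≤ Real.exp (p - q) * (1 / M ^ 2) * (1 / M ^ 2) :=
    h1.trans (mul_le_mul h2 hwp (sqLen_nonneg _ _ _) (by positivity))
  have hM4 : 0 < M ^ 4 := by positivity
  have : Real.exp (p - q) * (1 / M ^ 2) * (1 / M ^ 2) = Real.exp (p - q) / M ^ 4 := by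
    field_simp
  rw [this, le_div_iff₀ hM4] at h3
  linarith

/-- A single lattice vector is responsible for an uninterrupted excursion. -/
theorem exists_sqLen_le_on_Icc {M : ℝ} (hM : 2 ≤ M) {g : SL(2, ℝ)} {p q : ℤ} (hpq : p ≤ q)
    (h : ∀ t ∈ Set.Icc p q, IsShortAt M g t) :
    ∃ v : ℤ × ℤ, IsCoprime v.1 v.2 ∧ ∀ t ∈ Set.Icc p q, sqLen g v t ≤ 1 / M ^ 2 := by
  obtain ⟨v, hv, hvp⟩ := h p ⟨le_rfl, hpq⟩
  refine ⟨v, hv, ?_⟩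
  suffices ∀ t, p ≤ t → t ≤ q → sqLen g v t ≤ 1 / M ^ 2 from fun t ht => this t ht.1 ht.2
  intro t ht
  induction t, ht using Int.leInduction with
  | base => exact fun _ => hvp
  | succ t ht ih =>
    intro htq
    have ih := ih (by omega)
    obtain ⟨w, hw, hwt⟩ := h (t + 1) ⟨by omega, htq⟩
    have h1 : sqLen g v (t + 1) ≤ Real.exp 1 * (1 / M ^ 2) := by
      have := sqLen_le_exp_mul g v (show t ≤ t + 1 by omega)
      push_cast at this
      rw [add_sub_cancel_left] at this
      exact this.trans (by gcongr)
    have h2 : sqLen g v (t + 1) * sqLen g w (t + 1) < 1 := by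
      refine (mul_le_mul h1 hwt (sqLen_nonneg _ _ _) (by positivity)).trans_lt ?_
      have : 1 / M ^ 2 ≤ 1 / 4 := one_div_le_one_div_of_le (by norm_num) (by nlinarith)
      have he := Real.exp_one_lt_three
      calc Real.exp 1 * (1 / M ^ 2) * (1 / M ^ 2) ≤ 3 * (1 / 4) * (1 / 4) := by gcongr
        _ < 1 := by norm_num
    rw [← sqLen_eq_of_mul_lt_one hv hw h2]
    exact hwt

/-! ### Covering the unstable direction -/

/-- The lower triangular unipotent matrix with entry `r`. It moves points along the direction
that the flow expands. -/
noncomputable def lowerMat (r : ℝ) : SL(2, ℝ) := ⟨!![1, 0; r, 1], by simp⟩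

/-- The upper triangular matrix `(e^l, b; 0, e^{-l})`. It moves points along the directions that
the flow does not expand. -/
noncomputable def upperMat (l b : ℝ) : SL(2, ℝ) :=
  ⟨!![Real.exp l, b; 0, Real.exp (-l)], by
    rw [Matrix.det_fin_two_of, ← Real.exp_add]; simp⟩

theorem mul_apply_two (g h : SL(2, ℝ)) (i j : Fin 2) :
    (g * h) i j = g i 0 * h 0 j + g i 1 * h 1 j := by
  rw [Matrix.SpecialLinearGroup.coe_mul, Matrix.mul_apply, Fin.sum_univ_two]

theorem coordX_mul_lowerMat_mul_upperMat (g : SL(2, ℝ)) (r l b : ℝ) (v : ℤ × ℤ) :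
    coordX (g * lowerMat r * upperMat l b) v =
      Real.exp l * (coordX g v + r * coordY g v) := by
  simp only [coordX, coordY, mul_apply_two]
  simp [lowerMat, upperMat]
  ring

theorem coordY_mul_lowerMat_mul_upperMat (g : SL(2, ℝ)) (r l b : ℝ) (v : ℤ × ℤ) :
    coordY (g * lowerMat r * upperMat l b) v =
      b * (coordX g v + r * coordY g v) + Real.exp (-l) * coordY g v := by
  simp only [coordX, coordY, mul_apply_two]
  simp [lowerMat, upperMat]
  ring

/-- A `d`-separated set in an interval of length `hi - lo` is finite with at most
`(hi - lo) / d + 2` elements. -/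
theorem finite_and_ncard_le_of_separated {S : Set ℝ} {d lo hi : ℝ} (hd : 0 < d)
    (hS : S ⊆ Set.Icc lo hi) (hle : lo ≤ hi)
    (hsep : ∀ x ∈ S, ∀ y ∈ S, x < y → d ≤ y - x) :
    S.Finite ∧ (S.ncard : ℝ) ≤ (hi - lo) / d + 2 := by
  have hmaps : Set.MapsTo (fun x : ℝ => ⌊x / d⌋) S
      ((Finset.Icc ⌊lo / d⌋ ⌊hi / d⌋ : Finset ℤ) : Set ℤ) := by
    intro x hx
    have := hS hx
    simp only [Finset.coe_Icc, Set.mem_Icc]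
    exact ⟨Int.floor_le_floor (div_le_div_of_nonneg_right this.1 hd.le),
      Int.floor_le_floor (div_le_div_of_nonneg_right this.2 hd.le)⟩
  have hlt : ∀ x ∈ S, ∀ y ∈ S, x < y → ⌊x / d⌋ < ⌊y / d⌋ := by
    intro x hx y hy hxy
    have h1 : x / d + 1 ≤ y / d := by
      rw [← sub_nonneg]
      have : y / d - (x / d + 1) = (y - x - d) / d := by field_simp; ring
      rw [this]
      exact div_nonneg (by linarith [hsep x hx y hy hxy]) hd.le
    have := Int.floor_le_floor h1
    rw [Int.floor_add_one] at this
    omega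
  have hinj : Set.InjOn (fun x : ℝ => ⌊x / d⌋) S := by
    intro x hx y hy hxy
    simp only at hxy
    rcases lt_trichotomy x y with h | h | h
    · exact absurd hxy (hlt x hx y hy h).ne
    · exact h
    · exact absurd hxy.symm (hlt y hy x hx h).ne
  refine ⟨Set.Finite.of_injOn hmaps hinj (Finset.finite_toSet _), ?_⟩
  have h1 := Set.ncard_le_ncard_of_injOn _ hmaps hinj (Finset.finite_toSet _)
  rw [Set.ncard_coe_finset, Int.card_Icc] at h1
  have h2 : lo / d ≤ hi / d := div_le_div_of_nonneg_right hle hd.le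
  have h3 : (0 : ℤ) ≤ ⌊hi / d⌋ + 1 - ⌊lo / d⌋ := by
    have := Int.floor_le_floor h2
    omega
  have h4 : (((⌊hi / d⌋ + 1 - ⌊lo / d⌋).toNat : ℤ) : ℝ) = ⌊hi / d⌋ + 1 - ⌊lo / d⌋ := by
    rw [Int.toNat_of_nonneg h3]; push_cast; ring
  have h5 : (S.ncard : ℝ) ≤ (((⌊hi / d⌋ + 1 - ⌊lo / d⌋).toNat : ℤ) : ℝ) := by exact_mod_cast h1
  rw [h4] at h5
  have := Int.floor_le (hi / d)
  have := Int.lt_floor_add_one (lo / d)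
  rw [sub_div]
  linarith

/-- Let `v` be short from time `p` to time `q` but not at time `p - 1`, for a lattice close to
`ℤ² g lowerMat r`. Then the second coordinate of `v g` is about `e^{p/2} / M`, and `r` is close
to the slope at which the first coordinate of `v g lowerMat r` vanishes. -/
theorem coord_bounds_of_excursion {M : ℝ} (hM : 0 < M) {g : SL(2, ℝ)} {r l b : ℝ}
    (hl : |l| ≤ 1 / 20) (hb : |b| ≤ 1 / 20) {v : ℤ × ℤ} {p q : ℤ} (hp0 : 0 ≤ p) (hpq : p ≤ q)
    (hp : sqLen (g * lowerMat r * upperMat l b) v p ≤ 1 / M ^ 2)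
    (hq : sqLen (g * lowerMat r * upperMat l b) v q ≤ 1 / M ^ 2)
    (hp1 : 1 / M ^ 2 < sqLen (g * lowerMat r * upperMat l b) v (p - 1)) :
    coordY g v ≠ 0 ∧ coordY g v ^ 2 ≤ 2 * Real.exp p / M ^ 2 ∧
      |r - -coordX g v / coordY g v| ≤ 4 * Real.exp (-(p + q) / 2) := by
  have hX := coordX_mul_lowerMat_mul_upperMat g r l b v
  have hY := coordY_mul_lowerMat_mul_upperMat g r l b v
  unfold sqLen at hp hq hp1
  set X := coordX (g * lowerMat r * upperMat l b) v
  set Y := coordY (g * lowerMat r * upperMat l b) v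
  set z := coordX g v + r * coordY g v with hz
  set y := coordY g v
  set u := Real.exp ((p : ℝ) / 2) with hu
  set w := Real.exp (-(q : ℝ) / 2) with hw
  have hu0 : 0 < u := Real.exp_pos _
  have hw0 : 0 < w := Real.exp_pos _
  have hp0' : (0 : ℝ) ≤ p := by exact_mod_cast hp0
  have hpq' : (p : ℝ) ≤ q := by exact_mod_cast hpq
  have hu2 : Real.exp (p : ℝ) = u ^ 2 := by rw [hu, ← Real.exp_nat_mul]; congr 1; push_cast; ring
  have hw2 : Real.exp (q : ℝ) = (w ^ 2)⁻¹ := by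
    rw [hw, ← Real.exp_nat_mul, ← Real.exp_neg]; congr 1; push_cast; ring
  have huw : u * w ≤ 1 := by
    rw [hu, hw, ← Real.exp_add, Real.exp_le_one_iff]; linarith
  have hu1 : 1 ≤ u := Real.one_le_exp (by positivity)
  have hwu : w ≤ u := by
    have : 1 * w ≤ u * w := by gcongr
    linarith
  -- the two coordinates at the times `q` and `p`
  have hMX : M * |X| ≤ w := by
    refine abs_le_of_sq_le_sq' ?_ hw0.le |>.2
    have h1 : X ^ 2 * Real.exp q ≤ 1 / M ^ 2 := le_trans (by simp; positivity) hq
    rw [hw2, ← div_eq_mul_inv, div_le_div_iff₀ (by positivity) (by positivity)] at h1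
    rw [mul_pow, sq_abs]; linarith
  have hMY : M * |Y| ≤ u := by
    refine abs_le_of_sq_le_sq' ?_ hu0.le |>.2
    have h1 : Y ^ 2 * Real.exp (-p) ≤ 1 / M ^ 2 := le_trans (by simp; positivity) hp
    rw [Real.exp_neg, hu2, ← div_eq_mul_inv, div_le_div_iff₀ (by positivity) (by positivity)] at h1
    rw [mul_pow, sq_abs]; linarith
  -- at time `p - 1` the vector is still long, so its second coordinate cannot be too small
  have hMY' : 4 / 9 * u ≤ M * |Y| := by
    refine abs_le_of_sq_le_sq' ?_ (by positivity) |>.2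
    have e1 : Real.exp ((p - 1 : ℤ) : ℝ) = u ^ 2 / Real.exp 1 := by
      rw [← hu2, ← Real.exp_sub]; push_cast; rfl
    have e2 : Real.exp (-((p - 1 : ℤ) : ℝ)) = Real.exp 1 / u ^ 2 := by
      rw [← hu2, ← Real.exp_sub]; push_cast; ring_nf
    rw [e1, e2] at hp1
    have h1 : 1 < (M * |X|) ^ 2 * (u ^ 2 / Real.exp 1) + (M * |Y|) ^ 2 * (Real.exp 1 / u ^ 2) := by
      rw [div_lt_iff₀ (by positivity)] at hp1
      rw [mul_pow, mul_pow, sq_abs, sq_abs]; linarith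
    have h2 : (M * |X|) ^ 2 * u ^ 2 ≤ 1 := by
      have : M * |X| * u ≤ 1 := le_trans (by gcongr) (by linarith : w * u ≤ 1)
      rw [← mul_pow]
      exact pow_le_one₀ (by positivity) this
    have he1 := Real.exp_one_gt_d9
    have he2 := Real.exp_one_lt_d9
    have h3 : (M * |X|) ^ 2 * (u ^ 2 / Real.exp 1) ≤ 2 / 5 := by
      rw [← mul_div_assoc, div_le_iff₀ (by positivity)]; linarith
    have h4 : 3 / 5 * u ^ 2 ≤ (M * |Y|) ^ 2 * Real.exp 1 := by
      have : 3 / 5 ≤ (M * |Y|) ^ 2 * (Real.exp 1 / u ^ 2) := by linarith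
      rwa [← mul_div_assoc, le_div_iff₀ (by positivity)] at this
    have h5 : (M * |Y|) ^ 2 * Real.exp 1 ≤ (M * |Y|) ^ 2 * 2.72 := by gcongr; linarith
    have h6 : 0 ≤ u ^ 2 := by positivity
    rw [mul_pow]; linarith
  obtain ⟨hl1, hl2⟩ := abs_le.mp hl
  have hel : 19 / 20 ≤ Real.exp l := by linarith [Real.add_one_le_exp l]
  have hel' : 19 / 20 ≤ Real.exp (-l) := by linarith [Real.add_one_le_exp (-l)]
  have hmul : Real.exp l * Real.exp (-l) = 1 := by rw [← Real.exp_add]; simp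
  have hMz : M * |z| ≤ 20 / 19 * w := by
    rw [hX, abs_mul, abs_of_pos (Real.exp_pos l)] at hMX
    have : 19 / 20 * (M * |z|) ≤ Real.exp l * (M * |z|) := by gcongr
    linarith
  have hMbz : M * |b * z| ≤ 1 / 19 * u := by
    rw [abs_mul]
    have : |b| * (M * |z|) ≤ 1 / 20 * (20 / 19 * w) := by gcongr
    linarith
  have hMey : M * (Real.exp (-l) * |y|) ≤ 20 / 19 * u := by
    have h1 : Real.exp (-l) * |y| = |Y - b * z| := by
      rw [hY, add_sub_cancel_left, abs_mul, abs_of_pos (Real.exp_pos _)]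
    rw [h1]
    have := mul_le_mul_of_nonneg_left (abs_sub Y (b * z)) hM.le
    linarith
  have hMey' : 15 / 39 * u ≤ M * (Real.exp (-l) * |y|) := by
    have h1 : Real.exp (-l) * |y| = |Y - b * z| := by
      rw [hY, add_sub_cancel_left, abs_mul, abs_of_pos (Real.exp_pos _)]
    rw [h1]
    have := mul_le_mul_of_nonneg_left (abs_sub_abs_le_abs_sub Y (b * z)) hM.le
    linarith
  have hMy : M * |y| ≤ 7 / 5 * u := by
    have : 19 / 20 * (M * |y|) ≤ Real.exp (-l) * (M * |y|) := by gcongr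
    linarith
  have hMy' : 1 / 3 * u ≤ M * |y| := by
    have h1 : 19 / 20 * Real.exp (-l) ≤ Real.exp l * Real.exp (-l) := by gcongr
    have h2 : Real.exp (-l) * (M * |y|) ≤ 20 / 19 * (M * |y|) := by gcongr; linarith
    linarith
  have hy0 : 0 < |y| := by
    have : 0 < M * |y| := by linarith
    exact (pos_iff_pos_of_mul_pos this).mp hM
  refine ⟨abs_pos.mp hy0, ?_, ?_⟩
  · rw [le_div_iff₀ (by positivity), hu2]
    have : (M * |y|) ^ 2 ≤ (7 / 5 * u) ^ 2 := by gcongr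
    rw [mul_pow, mul_pow, sq_abs] at this
    have : 0 ≤ u ^ 2 := by positivity
    linarith
  · have h1 : r - -coordX g v / y = z / y := by
      rw [hz]; field_simp [abs_pos.mp hy0]; ring
    have h2 : Real.exp (-((p : ℝ) + q) / 2) = w / u := by
      rw [hw, hu, ← Real.exp_sub]; congr 1; ring
    rw [h1, h2, abs_div, div_le_iff₀ hy0, ← mul_div_assoc, div_mul_eq_mul_div, le_div_iff₀ hu0]
    have h3 : M * |z| * u ≤ 20 / 19 * w * u := by gcongr
    have h4 : 1 / 3 * u * w ≤ M * |y| * w := by gcongr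
    have h5 : M * (|z| * u) ≤ M * (4 * w * |y|) := by linarith [mul_pos hu0 hw0]
    exact le_of_mul_le_mul_left h5 hM

/-- Distinct slopes of lattice vectors with small second coordinate are well separated, as for
Farey fractions. -/
theorem le_abs_slope_sub {g : SL(2, ℝ)} {v w : ℤ × ℤ} {Y : ℝ} (hv : coordY g v ≠ 0)
    (hw : coordY g w ≠ 0) (hvY : coordY g v ^ 2 ≤ Y) (hwY : coordY g w ^ 2 ≤ Y)
    (hne : -coordX g v / coordY g v ≠ -coordX g w / coordY g w) :
    1 / Y ≤ |-coordX g v / coordY g v - -coordX g w / coordY g w| := by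
  have h0 : -coordX g v / coordY g v - -coordX g w / coordY g w =
      -((v.1 * w.2 - v.2 * w.1 : ℤ) : ℝ) / (coordY g v * coordY g w) := by
    push_cast
    rw [← coord_det g]
    field_simp
    ring
  have hdet : v.1 * w.2 - v.2 * w.1 ≠ 0 := by
    intro h
    rw [h] at h0
    simp only [Int.cast_zero, neg_zero, zero_div] at h0
    exact hne (sub_eq_zero.mp h0)
  have hdet' : (1 : ℝ) ≤ |((v.1 * w.2 - v.2 * w.1 : ℤ) : ℝ)| := by
    exact_mod_cast Int.one_le_abs hdet
  have hY : 0 < Y := lt_of_lt_of_le (by positivity) hvY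
  have hprod : |coordY g v * coordY g w| ≤ Y := by
    rw [abs_mul]
    nlinarith [sq_nonneg (|coordY g v| - |coordY g w|), sq_abs (coordY g v), sq_abs (coordY g w)]
  rw [h0, abs_div, abs_neg]
  have : 0 < |coordY g v * coordY g w| := abs_pos.mpr (mul_ne_zero hv hw)
  gcongr

theorem exists_finset_cover_interval (s : ℝ) {ρ d : ℝ} (hd : 0 < d) (hdρ : d ≤ ρ) :
    ∃ F : Finset ℝ, (F.card : ℝ) ≤ 2 * ρ / d ∧ ∀ r, |r - s| ≤ ρ → ∃ c ∈ F, |r - c| ≤ d := by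
  classical
  refine ⟨(Finset.range (⌊ρ / d⌋₊ + 1)).image (fun i : ℕ => s - ρ + (2 * i + 1) * d), ?_, ?_⟩
  · have h1 : ((Finset.range (⌊ρ / d⌋₊ + 1)).image
        (fun i : ℕ => s - ρ + (2 * i + 1) * d)).card ≤ ⌊ρ / d⌋₊ + 1 :=
      Finset.card_image_le.trans_eq (Finset.card_range _)
    have h2 : (⌊ρ / d⌋₊ : ℝ) ≤ ρ / d := Nat.floor_le (div_nonneg (hd.le.trans hdρ) hd.le)
    have h3 : 1 ≤ ρ / d := (one_le_div hd).mpr hdρ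
    have h4 : (((Finset.range (⌊ρ / d⌋₊ + 1)).image
        (fun i : ℕ => s - ρ + (2 * i + 1) * d)).card : ℝ) ≤ ⌊ρ / d⌋₊ + 1 := by exact_mod_cast h1
    rw [mul_div_assoc]
    linarith
  · intro r hr
    obtain ⟨hr1, hr2⟩ := abs_le.mp hr
    have h0 : 0 ≤ (r - s + ρ) / (2 * d) := div_nonneg (by linarith) (by linarith)
    refine ⟨_, Finset.mem_image_of_mem _ (Finset.mem_range.mpr
      (Nat.lt_succ_of_le (Nat.floor_le_floor (a := (r - s + ρ) / (2 * d)) ?_))), ?_⟩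
    · rw [div_le_div_iff₀ (by linarith) hd]; nlinarith
    · have h1 := Nat.floor_le h0
      have h2 := Nat.lt_floor_add_one ((r - s + ρ) / (2 * d))
      rw [le_div_iff₀ (by linarith)] at h1
      rw [div_lt_iff₀ (by linarith)] at h2
      rw [abs_le]
      constructor <;> linarith

/-- A nonempty finite set of integers starts with a maximal run `[p, q]` of consecutive
integers. -/
theorem exists_first_run {V : Finset ℤ} (hV : V.Nonempty) :
    ∃ p q, p ≤ q ∧ Finset.Icc p q ⊆ V ∧ (∀ t ∈ V, p ≤ t) ∧ q + 1 ∉ V := by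
  set p := V.min' hV
  have hp : p ∈ V := V.min'_mem hV
  have hne : (V.filter fun q => Finset.Icc p q ⊆ V).Nonempty := ⟨p, by simp [hp]⟩
  set q := (V.filter fun q => Finset.Icc p q ⊆ V).max' hne
  have hq := Finset.max'_mem _ hne
  rw [Finset.mem_filter] at hq
  refine ⟨p, q, V.min'_le q hq.1, hq.2, fun t ht => V.min'_le t ht, fun h => ?_⟩
  have : q + 1 ∈ V.filter fun q => Finset.Icc p q ⊆ V := by
    refine Finset.mem_filter.mpr ⟨h, fun t ht => ?_⟩
    rw [Finset.mem_Icc] at ht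
    rcases ht.2.lt_or_eq with h' | h'
    · exact hq.2 (Finset.mem_Icc.mpr ⟨ht.1, by omega⟩)
    · rwa [h']
  have := Finset.le_max' _ _ this
  omega

/-- The parameters `r` in `[s - ρ, s + ρ]` for which some lattice close to `ℤ² g lowerMat r` has
the excursion pattern `V` on `[m, n]` lie in a small number of intervals of radius `κ e^{-n}`.
The first excursion `[p, q]` forces `r` to be within `4 e^{-(p+q)/2}` of one of at most
`10 ρ e^p / M ^ 2` slopes; the remaining excursions are treated recursively in each of these
intervals. The factor `M ^ (-2)` beats the absolute constants lost in this step, which is what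
makes the final bound free of losses that depend on the number of excursions. -/
theorem exists_cover_of_pattern {M : ℝ} (hM : 9 ≤ M) (g : SL(2, ℝ)) {κ : ℝ} (hκ : 0 < κ)
    (hκ1 : κ ≤ 1) (n : ℤ) (V : Finset ℤ) :
    ∀ m : ℤ, 0 ≤ m → m ≤ n → (∀ t ∈ V, m < t ∧ t < n) → ∀ s ρ : ℝ, Real.exp (-n) ≤ ρ →
      (∀ p ∈ V, M ^ 2 * Real.exp (-p) ≤ ρ) →
      ∃ F : Finset ℝ, (F.card : ℝ) ≤ 2 / κ * ρ * Real.exp n * Real.exp (-(V.card : ℝ) / 2) ∧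
        ∀ r, |r - s| ≤ ρ → (∃ l b : ℝ, |l| ≤ 1 / 20 ∧ |b| ≤ 1 / 20 ∧
          HasPattern M (g * lowerMat r * upperMat l b) m n V) →
          ∃ c ∈ F, |r - c| ≤ κ * Real.exp (-n) := by
  classical
  induction V using Finset.strongInduction with
  | H V ih =>
  intro m hm hmn hVmn s ρ hρn hρV
  have hρ0 : 0 < ρ := (Real.exp_pos _).trans_le hρn
  rcases V.eq_empty_or_nonempty with rfl | hne
  · obtain ⟨F, hF, hF'⟩ := exists_finset_cover_interval s (ρ := ρ) (d := κ * Real.exp (-n))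
      (by positivity) (le_trans (mul_le_of_le_one_left (Real.exp_pos _).le hκ1) hρn)
    refine ⟨F, hF.trans_eq ?_, fun r hr _ => hF' r hr⟩
    rw [Real.exp_neg]
    simp
    field_simp
  -- if the pattern does not occur at all, there is nothing to cover
  by_cases hocc : ∃ r, ∃ l b : ℝ, |l| ≤ 1 / 20 ∧ |b| ≤ 1 / 20 ∧
      HasPattern M (g * lowerMat r * upperMat l b) m n V
  swap
  · exact ⟨∅, by simp; positivity, fun r _ h => absurd ⟨r, h⟩ hocc⟩
  obtain ⟨p, q, hpq, hIcc, hpmin, hq1⟩ := exists_first_run hne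
  have hpV : p ∈ V := hIcc (Finset.mem_Icc.mpr ⟨le_rfl, hpq⟩)
  have hqV : q ∈ V := hIcc (Finset.mem_Icc.mpr ⟨hpq, le_rfl⟩)
  have hmp := (hVmn p hpV).1
  have hqn := (hVmn q hqV).2
  have hpq' : (p : ℝ) ≤ q := by exact_mod_cast hpq
  have hqn' : (q : ℝ) ≤ n := by exact_mod_cast hqn.le
  set V' := V.filter (q < ·) with hV'
  have hV'sub : V' ⊆ V := Finset.filter_subset _ _
  have hssub : V' ⊂ V := Finset.ssubset_iff_of_subset hV'sub |>.mpr ⟨p, hpV, by simp [hV', hpq]⟩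
  have hcard : (V.card : ℝ) = q - p + 1 + V'.card := by
    have hun : V = Finset.Icc p q ∪ V' := by
      ext t
      rw [Finset.mem_union, Finset.mem_Icc, hV', Finset.mem_filter]
      constructor
      · intro h
        rcases le_or_gt t q with h' | h'
        · exact Or.inl ⟨hpmin t h, h'⟩
        · exact Or.inr ⟨h, h'⟩
      · rintro (h | h)
        · exact hIcc (Finset.mem_Icc.mpr h)
        · exact h.1
    have hdis : Disjoint (Finset.Icc p q) V' := by
      rw [Finset.disjoint_left]
      intro t ht ht'
      rw [Finset.mem_Icc] at ht
      rw [hV', Finset.mem_filter] at ht'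
      omega
    conv_lhs => rw [hun]
    rw [Finset.card_union_of_disjoint hdis, Int.card_Icc, Nat.cast_add]
    have : (((q + 1 - p).toNat : ℤ) : ℝ) = q - p + 1 := by
      rw [Int.toNat_of_nonneg (by omega)]; push_cast; ring
    rw [← this]; push_cast; rfl
  set ρ' := 4 * Real.exp (-((p : ℝ) + q) / 2) with hρ'
  have hρ'0 : 0 < ρ' := by positivity
  have hρ'q : Real.exp (-q) ≤ ρ' := by
    have : Real.exp (-q) ≤ Real.exp (-((p : ℝ) + q) / 2) := by
      apply Real.exp_le_exp.mpr; linarith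
    linarith [Real.exp_pos (-((p : ℝ) + q) / 2)]
  have hρ'p : ρ' ≤ 4 * Real.exp (-p) := by
    rw [hρ']; gcongr; linarith
  have hM0 : 0 < M := by linarith
  have hM2 : 81 ≤ M ^ 2 := by nlinarith
  have hexpp : Real.exp p * Real.exp (-p) = 1 := by rw [← Real.exp_add]; simp
  have hρp := hρV p hpV
  have hρ'ρ : ρ' ≤ ρ := by
    have : 4 * Real.exp (-p) ≤ M ^ 2 * Real.exp (-p) := by gcongr; linarith
    linarith
  -- the later excursions inside an interval of radius `ρ'`
  obtain ⟨r₀, l₀, b₀, -, -, hpat₀⟩ := hocc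
  have hrec := fun s' : ℝ => ih V' hssub (q + 1) (by omega) (by omega)
    (fun t ht => by
      rw [hV', Finset.mem_filter] at ht
      refine ⟨lt_of_le_of_ne ht.2 ?_, (hVmn t ht.1).2⟩
      rintro rfl
      exact hq1 ht.1) s' ρ'
    (le_trans (Real.exp_le_exp.mpr (by linarith)) hρ'q)
    (fun p' hp' => by
      rw [hV', Finset.mem_filter] at hp'
      have hp'n := (hVmn p' hp'.1)
      have hgap := pow_four_le_exp_of_gap (by linarith)
        ((hpat₀ q ⟨by omega, by omega⟩).mpr hqV)
        (fun h => hq1 ((hpat₀ (q + 1) ⟨by omega, by omega⟩).mp h))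
        ((hpat₀ p' ⟨by omega, by omega⟩).mpr hp'.1) hp'.2
      have h1 : Real.exp (-q) = Real.exp (p' - q) * Real.exp (-p') := by
        rw [← Real.exp_add]; congr 1; ring
      have h2 : M ^ 2 ≤ Real.exp ((p' : ℝ) - q) := by nlinarith
      calc M ^ 2 * Real.exp (-p') ≤ Real.exp ((p' : ℝ) - q) * Real.exp (-p') := by gcongr
        _ ≤ ρ' := by rwa [← h1])
  choose F hFcard hFcov using hrec
  -- the slopes available for the first excursion
  set Y := 2 * Real.exp p / M ^ 2 with hY
  have hY0 : 0 < Y := by positivity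
  set S : Set ℝ := {σ | σ ∈ Set.Icc (s - 2 * ρ) (s + 2 * ρ) ∧ ∃ v : ℤ × ℤ, coordY g v ≠ 0 ∧
    coordY g v ^ 2 ≤ Y ∧ σ = -coordX g v / coordY g v} with hS
  obtain ⟨hSfin, hScard⟩ := finite_and_ncard_le_of_separated (S := S) (d := 1 / Y)
    (lo := s - 2 * ρ) (hi := s + 2 * ρ) (by positivity) (fun σ h => h.1) (by linarith) (by
      rintro x ⟨-, v, hv, hvY, rfl⟩ y ⟨-, w, hw, hwY, rfl⟩ hxy
      have := le_abs_slope_sub hw hv hwY hvY hxy.ne'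
      rwa [abs_of_pos (by linarith)] at this)
  rw [Set.ncard_eq_toFinset_card S hSfin] at hScard
  have hScard' : (hSfin.toFinset.card : ℝ) ≤ 10 * ρ * Real.exp p / M ^ 2 := by
    refine hScard.trans ?_
    have h1 : (s + 2 * ρ - (s - 2 * ρ)) / (1 / Y) = 8 * ρ * Real.exp p / M ^ 2 := by
      rw [hY]; field_simp; ring
    have h2 : 1 ≤ ρ * Real.exp p / M ^ 2 := by
      rw [one_le_div (by positivity)]
      calc M ^ 2 = M ^ 2 * Real.exp (-p) * Real.exp p := by
            rw [mul_assoc, mul_comm (Real.exp _), hexpp, mul_one]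
        _ ≤ ρ * Real.exp p := by gcongr
    rw [h1]
    have h3 : 10 * ρ * Real.exp p / M ^ 2 =
      8 * ρ * Real.exp p / M ^ 2 + 2 * (ρ * Real.exp p / M ^ 2) := by ring
    linarith
  refine ⟨hSfin.toFinset.biUnion F, ?_, ?_⟩
  · have h1 : ((hSfin.toFinset.biUnion F).card : ℝ) ≤ ∑ σ ∈ hSfin.toFinset, ((F σ).card : ℝ) := by
      exact_mod_cast Finset.card_biUnion_le
    have h2 : ∑ σ ∈ hSfin.toFinset, ((F σ).card : ℝ) ≤ hSfin.toFinset.card •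
        (2 / κ * ρ' * Real.exp n * Real.exp (-(V'.card : ℝ) / 2)) :=
      Finset.sum_le_card_nsmul _ _ _ fun σ _ => hFcard σ
    refine h1.trans (h2.trans ?_)
    rw [nsmul_eq_mul]
    have h3 : Real.exp p * ρ' * Real.exp (-(V'.card : ℝ) / 2) =
        4 * Real.exp (1 / 2) * Real.exp (-(V.card : ℝ) / 2) := by
      rw [hρ', hcard]
      have : Real.exp p * Real.exp (-((p : ℝ) + q) / 2) * Real.exp (-(V'.card : ℝ) / 2) =
          Real.exp (1 / 2) * Real.exp (-((q : ℝ) - p + 1 + V'.card) / 2) := by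
        rw [← Real.exp_add, ← Real.exp_add, ← Real.exp_add]; congr 1; ring
      linear_combination 4 * this
    have h4 : Real.exp (1 / 2) ≤ 17 / 10 := by
      have h5 : Real.exp (1 / 2) ^ 2 = Real.exp 1 := by
        rw [← Real.exp_nat_mul]; norm_num
      have := Real.exp_one_lt_d9
      exact abs_le_of_sq_le_sq' (by rw [h5]; linarith) (by norm_num) |>.2
    have h6 : 40 * Real.exp (1 / 2) / M ^ 2 ≤ 1 := by
      rw [div_le_one (by positivity)]; linarith
    calc (hSfin.toFinset.card : ℝ) *
          (2 / κ * ρ' * Real.exp n * Real.exp (-(V'.card : ℝ) / 2))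
        ≤ 10 * ρ * Real.exp p / M ^ 2 *
          (2 / κ * ρ' * Real.exp n * Real.exp (-(V'.card : ℝ) / 2)) := by gcongr
      _ = 2 / κ * ρ * Real.exp n * (10 / M ^ 2) *
          (Real.exp p * ρ' * Real.exp (-(V'.card : ℝ) / 2)) := by ring
      _ = 40 * Real.exp (1 / 2) / M ^ 2 *
          (2 / κ * ρ * Real.exp n * Real.exp (-(V.card : ℝ) / 2)) := by rw [h3]; ring
      _ ≤ 1 * (2 / κ * ρ * Real.exp n * Real.exp (-(V.card : ℝ) / 2)) := by gcongr
      _ = _ := one_mul _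
  · rintro r hr ⟨l, b, hl, hb, hpat⟩
    obtain ⟨v, hv, hvle⟩ := exists_sqLen_le_on_Icc (M := M) (by linarith) hpq
      (g := g * lowerMat r * upperMat l b) (fun t ht =>
        (hpat t ⟨by linarith [ht.1], by linarith [ht.2]⟩).mpr (hIcc (Finset.mem_Icc.mpr ht)))
    have hp1 : 1 / M ^ 2 < sqLen (g * lowerMat r * upperMat l b) v (p - 1) := by
      by_contra hcon
      have := (hpat (p - 1) ⟨by omega, by omega⟩).mp ⟨v, hv, not_lt.mp hcon⟩
      have := hpmin _ this
      omega
    obtain ⟨hy, hyY, hrv⟩ := coord_bounds_of_excursion hM0 hl hb (by omega) hpq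
      (hvle p ⟨le_rfl, hpq⟩) (hvle q ⟨hpq, le_rfl⟩) hp1
    have hσ : -coordX g v / coordY g v ∈ hSfin.toFinset := by
      rw [Set.Finite.mem_toFinset]
      refine ⟨?_, v, hy, hyY, rfl⟩
      obtain ⟨h1, h2⟩ := abs_le.mp hr
      obtain ⟨h3, h4⟩ := abs_le.mp (hrv.trans hρ'ρ)
      constructor <;> linarith
    obtain ⟨c, hc, hrc⟩ := hFcov _ r hrv ⟨l, b, hl, hb, fun t ht => by
      rw [hpat t ⟨by linarith [ht.1], ht.2⟩, hV', Finset.mem_filter]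
      exact ⟨fun h => ⟨h, by linarith [ht.1]⟩, fun h => h.1⟩⟩
    exact ⟨c, Finset.mem_biUnion.mpr ⟨_, hσ, hc⟩, hrc⟩

/-! ### Height and short vectors -/

theorem coe_a_zpow (t : ℤ) : ((a ^ t : SL(2, ℝ)) : Matrix (Fin 2) (Fin 2) ℝ) =
    !![Real.exp (t / 2), 0; 0, Real.exp (-(t / 2))] := by
  have hnat : ∀ k : ℕ, ((a ^ k : SL(2, ℝ)) : Matrix (Fin 2) (Fin 2) ℝ) =
      !![Real.exp (k / 2), 0; 0, Real.exp (-(k / 2))] := by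
    intro k
    induction k with
    | zero => simp [Matrix.one_fin_two]
    | succ k ih =>
      rw [pow_succ, Matrix.SpecialLinearGroup.coe_mul, ih]
      ext i j
      fin_cases i <;> fin_cases j <;>
        simp [a, Matrix.mul_apply, Fin.sum_univ_two, ← Real.exp_add] <;> ring
  cases t with
  | ofNat k => simpa using hnat k
  | negSucc k =>
    rw [zpow_negSucc, Matrix.SpecialLinearGroup.coe_inv, hnat]
    ext i j
    fin_cases i <;> fin_cases j <;> simp [Matrix.adjugate_fin_two] <;> ring

theorem T_zpow_mk (g : SL(2, ℝ)) (t : ℤ) : (T ^ t) (X.mk g) = X.mk (g * a ^ t) := by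
  induction t using Int.induction_on with
  | zero => simp
  | succ k ih =>
    rw [zpow_add_one, zpow_add_one, ← mul_assoc, (Commute.zpow_self T k).eq, Equiv.Perm.mul_apply,
      ih]
    rfl
  | pred k ih =>
    rw [zpow_sub_one, zpow_sub_one, ← mul_assoc, ((Commute.zpow_self T (-k)).inv_right).eq,
      Equiv.Perm.mul_apply, ih]
    rfl

theorem vecMul_norm_sq (g : SL(2, ℝ)) (t : ℤ) (v : Fin 2 → ℤ) :
    ‖WithLp.toLp 2 (Matrix.vecMul (fun i => (v i : ℝ))
      ((g * a ^ t : SL(2, ℝ)) : Matrix (Fin 2) (Fin 2) ℝ))‖ ^ 2 = sqLen g (v 0, v 1) t := by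
  have h1 : Real.exp ((t : ℝ) / 2) ^ 2 = Real.exp t := by
    rw [← Real.exp_nat_mul]; congr 1; push_cast; ring
  have h2 : Real.exp (-((t : ℝ) / 2)) ^ 2 = Real.exp (-t) := by
    rw [← Real.exp_nat_mul]; congr 1; push_cast; ring
  rw [EuclideanSpace.norm_sq_eq, Fin.sum_univ_two]
  simp only [Real.norm_eq_abs, sq_abs, Matrix.vecMul, dotProduct, Fin.sum_univ_two,
    mul_apply_two, coe_a_zpow, sqLen, coordX, coordY, ← h1, ← h2]
  simp
  ring

/-- The infimum defining the height is attained: a ball contains only finitely many lattice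
vectors. -/
theorem exists_sqLen_min (g : SL(2, ℝ)) (t : ℤ) :
    ∃ v : ℤ × ℤ, v ≠ 0 ∧ ∀ w : ℤ × ℤ, w ≠ 0 → sqLen g v t ≤ sqLen g w t := by
  set R := sqLen g (1, 0) t
  set R' := sqLen g (0, 1) t
  have hfin : {v : ℤ × ℤ | v ≠ 0 ∧ sqLen g v t ≤ R}.Finite := by
    set K := ⌈R * R + R * R'⌉
    have hbox : ∀ x : ℤ, ((x : ℝ) ^ 2 ≤ R * R + R * R') → x ∈ Set.Icc (-K) K := by
      intro x hx
      have h1 : ((x ^ 2 : ℤ) : ℝ) ≤ (K : ℝ) := by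
        push_cast; exact hx.trans (Int.le_ceil _)
      have h2 : x ^ 2 ≤ K := by exact_mod_cast h1
      constructor <;> nlinarith
    refine ((Set.finite_Icc (-K) K).prod (Set.finite_Icc (-K) K)).subset ?_
    rintro v ⟨-, hv⟩
    have hR : 0 ≤ R := sqLen_nonneg _ _ _
    have hR' : 0 ≤ R' := sqLen_nonneg _ _ _
    have h1 := coord_det_sq_le g v (0, 1) t
    have h2 := coord_det_sq_le g v (1, 0) t
    rw [coord_det] at h1 h2
    have h3 : sqLen g v t * R' ≤ R * R' := by gcongr
    have h4 : sqLen g v t * R ≤ R * R := by gcongr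
    simp at h1 h2
    refine ⟨hbox _ ?_, hbox _ ?_⟩ <;> nlinarith
  obtain ⟨v, hv, hmin⟩ := Set.exists_min_image _ (fun v => sqLen g v t) hfin
    ⟨(1, 0), by simp, le_rfl⟩
  refine ⟨v, hv.1, fun w hw => ?_⟩
  rcases le_or_gt (sqLen g w t) R with h | h
  · exact hmin w ⟨hw, h⟩
  · exact hv.2.trans h.le

theorem exists_isCoprime_sqLen_le (g : SL(2, ℝ)) (t : ℤ) {v : ℤ × ℤ} (hv : v ≠ 0) :
    ∃ w : ℤ × ℤ, IsCoprime w.1 w.2 ∧ sqLen g w t ≤ sqLen g v t := by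
  obtain ⟨x, y⟩ := v
  have hne : x ≠ 0 ∨ y ≠ 0 := by
    by_contra hcon
    push Not at hcon
    exact hv (by rw [hcon.1, hcon.2]; rfl)
  obtain ⟨d, x', y', hd, hcop, hx, hy⟩ := Int.exists_gcd_one' (Int.gcd_pos_iff.mpr hne)
  refine ⟨(x', y'), Int.isCoprime_iff_gcd_eq_one.mpr hcop, ?_⟩
  have h1 : sqLen g (x, y) t = (d : ℝ) ^ 2 * sqLen g (x', y') t := by
    simp only [sqLen, coordX, coordY, hx, hy]; push_cast; ring
  rw [h1]
  exact le_mul_of_one_le_left (sqLen_nonneg _ _ _) (one_le_pow₀ (by exact_mod_cast hd))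

theorem sqLen_pos (g : SL(2, ℝ)) {v : ℤ × ℤ} (hv : v ≠ 0) (t : ℤ) : 0 < sqLen g v t := by
  refine lt_of_le_of_ne (sqLen_nonneg _ _ _) fun h => hv ?_
  have hz : ∀ w : ℤ × ℤ, (v.1 : ℝ) * w.2 - v.2 * w.1 = 0 := by
    intro w
    have := coord_det_sq_le g v w t
    rw [coord_det, ← h, zero_mul] at this
    exact pow_eq_zero_iff two_ne_zero |>.mp (le_antisymm this (sq_nonneg _))
  have h1 := hz (0, 1)
  have h2 := hz (1, 0)
  simp at h1 h2
  exact Prod.ext h1 h2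

/-- A lattice is in the part of height at least `M` exactly when it has a primitive vector of
length at most `1 / M`. -/
theorem le_ht_iff_isShortAt {M : ℝ} (hM : 0 < M) (g : SL(2, ℝ)) (t : ℤ) :
    M ≤ ht ((T ^ t) (X.mk g)) ↔ IsShortAt M g t := by
  rw [T_zpow_mk]
  change M ≤ (sInf (latticeNorms (g * a ^ t)))⁻¹ ↔ _
  obtain ⟨v, hv, hmin⟩ := exists_sqLen_min g t
  have hlen : ∀ w : Fin 2 → ℤ, ‖WithLp.toLp 2 (Matrix.vecMul (fun i => (w i : ℝ))
      ((g * a ^ t : SL(2, ℝ)) : Matrix (Fin 2) (Fin 2) ℝ))‖ = Real.sqrt (sqLen g (w 0, w 1) t) := by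
    intro w
    rw [← vecMul_norm_sq, Real.sqrt_sq (norm_nonneg _)]
  have hinf : sInf (latticeNorms (g * a ^ t)) = Real.sqrt (sqLen g v t) := by
    refine IsLeast.csInf_eq ⟨⟨![v.1, v.2], ?_, ?_⟩, ?_⟩
    · intro h
      exact hv (Prod.ext (by simpa using congrFun h 0) (by simpa using congrFun h 1))
    · rw [hlen]; rfl
    · rintro r ⟨w, hw, rfl⟩
      rw [hlen]
      refine Real.sqrt_le_sqrt (hmin _ fun h => hw ?_)
      rw [Prod.ext_iff] at h
      ext i
      fin_cases i
      · exact h.1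
      · exact h.2
  have hpos := sqLen_pos g hv t
  have hiff : M ≤ (Real.sqrt (sqLen g v t))⁻¹ ↔ sqLen g v t ≤ 1 / M ^ 2 := by
    rw [le_inv_comm₀ hM (Real.sqrt_pos.mpr hpos), Real.sqrt_le_left (by positivity), inv_pow,
      one_div]
  rw [hinf, hiff]
  constructor
  · intro h
    obtain ⟨w, hw, hle⟩ := exists_isCoprime_sqLen_le g t hv
    exact ⟨w, hw, hle.trans h⟩
  · rintro ⟨w, hw, hle⟩
    refine (hmin w ?_).trans hle
    rintro rfl
    exact not_isCoprime_zero_zero hw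

/-! ### Reduction theory -/

/-- Every point of height less than `M` has a representative with bounded entries. -/
theorem exists_bounded_representative {M : ℝ} (hM : 1 ≤ M) (x : X) (hx : ht x < M) :
    ∃ g : SL(2, ℝ), x = X.mk g ∧ ∀ i j, |g i j| ≤ 2 * M := by
  induction x using Quotient.inductionOn with
  | h g =>
  change ht (X.mk g) < M at hx
  obtain ⟨γ, hγ⟩ := ModularGroup.exists_smul_mem_fd (g • UpperHalfPlane.I)
  set g' : SL(2, ℝ) := Matrix.SpecialLinearGroup.map (Int.castRingHom ℝ) γ * g with hg'
  have hmk : X.mk g = X.mk g' := by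
    refine Quotient.sound (QuotientGroup.rightRel_apply.mpr ?_)
    rw [hg', mul_inv_cancel_right]
    exact ⟨γ, rfl⟩
  have hsmul : γ • g • UpperHalfPlane.I = g' • UpperHalfPlane.I := by
    rw [hg', mul_smul]
    rfl
  rw [hsmul] at hγ
  refine ⟨g', hmk, ?_⟩
  rw [hmk] at hx
  set τ := g' • UpperHalfPlane.I with hτ
  have hτ' := UpperHalfPlane.coe_specialLinearGroup_apply g' UpperHalfPlane.I
  have hdet := g'.det_coe
  rw [Matrix.det_fin_two] at hdet
  have hτ3 := ModularGroup.three_le_four_mul_im_sq_of_mem_fd hγ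
  have hτ2 : |τ.re| ≤ 1 / 2 := hγ.2
  have hlow : 1 / M ^ 2 < g' 1 0 ^ 2 + g' 1 1 ^ 2 := by
    by_contra hcon
    have h1 : IsShortAt M g' 0 := by
      refine ⟨(0, 1), isCoprime_zero_left.mpr isUnit_one, ?_⟩
      have : sqLen g' (0, 1) 0 = g' 1 0 ^ 2 + g' 1 1 ^ 2 := by simp [sqLen, coordX, coordY]
      rw [this]
      exact not_lt.mp hcon
    have h2 := (le_ht_iff_isShortAt (by linarith) g' 0).mpr h1
    rw [zpow_zero, Equiv.Perm.one_apply] at h2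
    linarith
  have hN : 0 < g' 1 0 ^ 2 + g' 1 1 ^ 2 := lt_trans (by positivity) hlow
  simp only [Algebra.algebraMap_self, RingHom.id_apply, UpperHalfPlane.coe_I] at hτ'
  have hre : τ.re = (g' 0 0 * g' 1 0 + g' 0 1 * g' 1 1) / (g' 1 0 ^ 2 + g' 1 1 ^ 2) := by
    rw [← UpperHalfPlane.coe_re, hτ', Complex.div_re]
    simp [Complex.normSq_apply]
    rw [← add_div]
    congr 1 <;> ring
  have him : τ.im = 1 / (g' 1 0 ^ 2 + g' 1 1 ^ 2) := by
    rw [← UpperHalfPlane.coe_im, hτ', Complex.div_im]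
    simp [Complex.normSq_apply]
    rw [← sub_div, inv_eq_one_div]
    rw [div_eq_div_iff (by nlinarith) hN.ne']
    linear_combination (g' 1 0 ^ 2 + g' 1 1 ^ 2) * hdet
  rw [hre] at hτ2
  rw [him] at hτ3
  rw [Fin.forall_fin_two, Fin.forall_fin_two, Fin.forall_fin_two]
  generalize g' 0 0 = A at *
  generalize g' 0 1 = B at *
  generalize g' 1 0 = C at *
  generalize g' 1 1 = D at *
  have hM0 : 0 < M := by linarith
  have hid : (A ^ 2 + B ^ 2) * (C ^ 2 + D ^ 2) = 1 + (A * C + B * D) ^ 2 := by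
    linear_combination (A * D - B * C + 1) * hdet
  set n := C ^ 2 + D ^ 2
  have hn1 : 1 ≤ n * M ^ 2 := by
    rw [div_lt_iff₀ (by positivity)] at hlow; exact hlow.le
  have hn2 : n ≤ 2 := by
    rw [div_pow, one_pow, ← mul_div_assoc, le_div_iff₀ (by positivity)] at hτ3
    nlinarith
  rw [abs_div, abs_of_pos hN, div_le_iff₀ hN] at hτ2
  have hsq : (A * C + B * D) ^ 2 ≤ (1 / 2 * n) ^ 2 := by
    rw [← sq_abs]; gcongr
  have htop : A ^ 2 + B ^ 2 ≤ (2 * M) ^ 2 := by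
    have h1 : n * (A ^ 2 + B ^ 2) ≤ n * ((2 * M) ^ 2) := by nlinarith
    exact le_of_mul_le_mul_left h1 hN
  have hbot : C ^ 2 + D ^ 2 ≤ (2 * M) ^ 2 := by
    change n ≤ _
    nlinarith
  have hent : ∀ y z : ℝ, y ^ 2 + z ^ 2 ≤ (2 * M) ^ 2 → |y| ≤ 2 * M ∧ |z| ≤ 2 * M :=
    fun y z h => ⟨abs_le_of_sq_le_sq (by nlinarith) (by linarith),
      abs_le_of_sq_le_sq (by nlinarith) (by linarith)⟩
  exact ⟨hent A B htop, hent C D hbot⟩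

/-- Coordinates near the identity: every matrix near the identity is a product of a small
expanded displacement and a small displacement that is not expanded. -/
theorem exists_eq_lowerMat_mul_upperMat {δ : ℝ} (hδ : 0 < δ) :
    ∃ ε : ℝ, 0 < ε ∧ ∀ k : SL(2, ℝ), (∀ i j, |k i j - (1 : SL(2, ℝ)) i j| ≤ ε) →
      ∃ r l b : ℝ, |r| ≤ δ ∧ |l| ≤ δ ∧ |b| ≤ δ ∧ k = lowerMat r * upperMat l b := by
  refine ⟨min (1 / 2) (δ / 2), by positivity, fun k hk => ?_⟩
  set ε := min (1 / 2) (δ / 2)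
  have hε1 : ε ≤ 1 / 2 := min_le_left _ _
  have hε2 : ε ≤ δ / 2 := min_le_right _ _
  have h00 := hk 0 0
  have h01 := hk 0 1
  have h10 := hk 1 0
  simp at h00 h01 h10
  obtain ⟨h1, h2⟩ := abs_le.mp h00
  have hpos : 0 < k 0 0 := by linarith
  have hdet := k.det_coe
  rw [Matrix.det_fin_two] at hdet
  refine ⟨k 1 0 / k 0 0, Real.log (k 0 0), k 0 1, ?_, ?_, by linarith, ?_⟩
  · rw [abs_div, abs_of_pos hpos, div_le_iff₀ hpos]; nlinarith
  · rw [abs_le]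
    have h3 := Real.log_le_sub_one_of_pos hpos
    have h4 := Real.one_sub_inv_le_log_of_pos hpos
    have h5 : (k 0 0 : ℝ)⁻¹ ≤ 1 + δ := by
      rw [inv_le_iff_one_le_mul₀ hpos]; nlinarith
    constructor <;> linarith
  · ext i j
    rw [mul_apply_two]
    fin_cases i <;> fin_cases j <;>
      simp [lowerMat, upperMat, Real.exp_log hpos, Real.exp_neg]
    · field_simp
    · field_simp; linarith

/-- Matrices with bounded entries are covered by finitely many small neighbourhoods. -/
theorem exists_finset_net (R : ℝ) {δ : ℝ} (hδ : 0 < δ) :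
    ∃ G : Finset SL(2, ℝ), ∀ g : SL(2, ℝ), (∀ i j, |g i j| ≤ R) →
      ∃ g₀ ∈ G, ∃ r l b : ℝ, |r| ≤ δ ∧ |l| ≤ δ ∧ |b| ≤ δ ∧
        g = g₀ * lowerMat r * upperMat l b := by
  classical
  obtain ⟨ε, hε, hdec⟩ := exists_eq_lowerMat_mul_upperMat hδ
  set K : Set SL(2, ℝ) := {g | ∀ i j, |g i j| ≤ R}
  set f : SL(2, ℝ) → Fin 2 → Fin 2 → ℝ := fun g i j => g i j
  have htb : TotallyBounded (f '' K) := by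
    refine TotallyBounded.subset ?_
      (isCompact_closedBall (0 : Fin 2 → Fin 2 → ℝ) |R|).totallyBounded
    rintro _ ⟨g, hg, rfl⟩
    rw [mem_closedBall_zero_iff, pi_norm_le_iff_of_nonneg (abs_nonneg R)]
    intro i
    rw [pi_norm_le_iff_of_nonneg (abs_nonneg R)]
    exact fun j => (hg i j).trans (le_abs_self R)
  obtain ⟨t, htK, htfin, hcov⟩ := Metric.finite_approx_of_totallyBounded htb
    (ε / (2 * |R| + 1)) (by positivity)
  have htK' : ∀ y, y ∈ t → ∃ k ∈ K, f k = y := fun y hy => htK hy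
  choose! k hkK hkf using htK'
  refine ⟨htfin.toFinset.image k, fun g hg => ?_⟩
  obtain ⟨y, hy, hgy⟩ := Set.mem_iUnion₂.mp (hcov ⟨g, hg, rfl⟩)
  have hdist : ∀ i j, |g i j - k y i j| ≤ ε / (2 * |R| + 1) := by
    intro i j
    rw [← hkf y hy, Metric.mem_ball, dist_eq_norm] at hgy
    exact (norm_le_pi_norm ((f g - f (k y)) i) j).trans
      ((norm_le_pi_norm (f g - f (k y)) i).trans hgy.le)
  have hR : ∀ i j, |k y i j| ≤ |R| := fun i j => (hkK y hy i j).trans (le_abs_self R)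
  obtain ⟨r, l, b, hr, hl, hb, heq⟩ := hdec ((k y)⁻¹ * g) (by
    have hbound : ∀ p q x z : ℝ, |p| ≤ |R| → |q| ≤ |R| → |x| ≤ ε / (2 * |R| + 1) →
        |z| ≤ ε / (2 * |R| + 1) → |p * x + q * z| ≤ ε := by
      intro p q x z hp hq hx hz
      calc |p * x + q * z| ≤ |p| * |x| + |q| * |z| := by
            rw [← abs_mul, ← abs_mul]; exact abs_add_le _ _
        _ ≤ |R| * (ε / (2 * |R| + 1)) + |R| * (ε / (2 * |R| + 1)) := by gcongr
        _ = ε * ((2 * |R|) / (2 * |R| + 1)) := by ring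
        _ ≤ ε * 1 := by
          gcongr
          rw [div_le_one (by positivity)]
          linarith
        _ = ε := mul_one _
    intro i j
    have h1 : ((k y)⁻¹ * g) i j - (1 : SL(2, ℝ)) i j =
        (k y)⁻¹ i 0 * (g 0 j - k y 0 j) + (k y)⁻¹ i 1 * (g 1 j - k y 1 j) := by
      rw [← inv_mul_cancel (k y), mul_apply_two, mul_apply_two]; ring
    have h2 : ∀ i j, |(k y)⁻¹ i j| ≤ |R| := by
      intro i j
      rw [Matrix.SpecialLinearGroup.coe_inv, Matrix.adjugate_fin_two]
      fin_cases i <;> fin_cases j <;> simp [hR]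
    rw [h1]
    exact hbound _ _ _ _ (h2 _ _) (h2 _ _) (hdist _ _) (hdist _ _))
  exact ⟨k y, Finset.mem_image_of_mem _ (htfin.mem_toFinset.mpr hy), r, l, b, hr, hl, hb, by
    rw [mul_assoc, ← heq, mul_inv_cancel_left]⟩

/-! ### Riemannian balls and Bowen balls -/

theorem riemDist_le_curveLength (B : LinearMap.BilinForm ℝ (Matrix (Fin 2) (Fin 2) ℝ))
    (c : ℝ → SL(2, ℝ))
    (hc : ∀ i j, ContDiff ℝ 1 (fun t => (c t : Matrix (Fin 2) (Fin 2) ℝ) i j)) :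
    riemDist B (c 0) (c 1) ≤ curveLength B c := by
  refine csInf_le ⟨0, ?_⟩ ⟨c, hc, rfl, rfl, rfl⟩
  rintro l ⟨c', -, -, -, rfl⟩
  exact intervalIntegral.integral_nonneg zero_le_one fun t _ => Real.sqrt_nonneg _

theorem exists_bilinForm_bound (B : LinearMap.BilinForm ℝ (Matrix (Fin 2) (Fin 2) ℝ)) :
    ∃ K : ℝ, 0 ≤ K ∧ ∀ (w : Matrix (Fin 2) (Fin 2) ℝ) (e : ℝ), (∀ i j, |w i j| ≤ e) →
      B w w ≤ K * e ^ 2 := by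
  refine ⟨∑ i, ∑ j, ∑ i', ∑ j', |B (Matrix.single i' j' 1) (Matrix.single i j 1)|,
    by positivity, fun w e hw => ?_⟩
  have he : 0 ≤ e := (abs_nonneg _).trans (hw 0 0)
  have hsum : B w w = ∑ i, ∑ j, ∑ i', ∑ j', w i j * (w i' j' *
      B (Matrix.single i' j' 1) (Matrix.single i j 1)) := by
    conv_lhs => rw [Matrix.matrix_eq_sum_single w]
    have hsingle : ∀ i j, Matrix.single i j (w i j) = w i j • Matrix.single i j (1 : ℝ) := by
      intro i j; rw [Matrix.smul_single, smul_eq_mul, mul_one]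
    simp only [hsingle, map_sum, LinearMap.sum_apply, map_smul, LinearMap.smul_apply, smul_eq_mul]
    simp only [Finset.mul_sum]
  rw [hsum]
  simp only [Finset.sum_mul]
  refine Finset.sum_le_sum fun i _ => Finset.sum_le_sum fun j _ => Finset.sum_le_sum fun i' _ =>
    Finset.sum_le_sum fun j' _ => (le_abs_self _).trans ?_
  rw [abs_mul, abs_mul]
  calc |w i j| * (|w i' j'| * |B (Matrix.single i' j' 1) (Matrix.single i j 1)|)
      ≤ e * (e * |B (Matrix.single i' j' 1) (Matrix.single i j 1)|) := by
        gcongr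
        · exact hw i j
        · exact hw i' j'
    _ = _ := by ring

/-- The curve `t ↦ lowerMat (t r) * upperMat (t l) (t b)` shows that matrices with small
coordinates are close to the identity in the Riemannian metric. -/
theorem exists_lowerMat_mul_upperMat_mem_groupBall
    (B : LinearMap.BilinForm ℝ (Matrix (Fin 2) (Fin 2) ℝ)) {η : ℝ} (hη : 0 < η) :
    ∃ ε : ℝ, 0 < ε ∧ ∀ r l b : ℝ, |r| ≤ ε → |l| ≤ ε → |b| ≤ ε →
      lowerMat r * upperMat l b ∈ groupBall B η := by
  obtain ⟨K, hK0, hK⟩ := exists_bilinForm_bound B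
  refine ⟨min 1 (η / (100 * (Real.sqrt K + 1))), by positivity, fun r l b hr hl hb => ?_⟩
  set ε := min 1 (η / (100 * (Real.sqrt K + 1)))
  have hε0 : 0 ≤ ε := (abs_nonneg _).trans hr
  have hε1 : ε ≤ 1 := min_le_left _ _
  have hε2 : 100 * (Real.sqrt K + 1) * ε ≤ η := by
    have : ε ≤ η / (100 * (Real.sqrt K + 1)) := min_le_right _ _
    rw [le_div_iff₀ (by positivity)] at this
    linarith
  set c : ℝ → SL(2, ℝ) := fun t => lowerMat (t * r) * upperMat (t * l) (t * b) with hc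
  have hcoe : ∀ t, (c t : Matrix (Fin 2) (Fin 2) ℝ) =
      !![Real.exp (t * l), t * b; t * r * Real.exp (t * l),
        t * r * (t * b) + Real.exp (-(t * l))] := by
    intro t
    ext i j
    rw [hc, mul_apply_two]
    fin_cases i <;> fin_cases j <;> simp [lowerMat, upperMat]
  have hsmooth : ∀ i j, ContDiff ℝ 1 (fun t => (c t : Matrix (Fin 2) (Fin 2) ℝ) i j) := by
    intro i j
    simp only [hcoe]
    fin_cases i <;> fin_cases j <;> simp <;> fun_prop
  have hc0 : c 0 = 1 := by
    ext i j
    rw [hcoe]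
    fin_cases i <;> fin_cases j <;> simp
  have hc1 : c 1 = lowerMat r * upperMat l b := by simp [hc]
  have hbound : ∀ t ∈ Set.Icc (0 : ℝ) 1, ∀ i j, |leftVelocity c t i j| ≤ 48 * ε := by
    have hlm : ∀ t, HasDerivAt (fun t : ℝ => t * l) l t := fun t => by
      simpa using (hasDerivAt_id t).mul_const l
    have hder : ∀ t, velocity c t = !![Real.exp (t * l) * l, b;
        r * Real.exp (t * l) + t * r * (Real.exp (t * l) * l),
        2 * (t * r * b) - Real.exp (-(t * l)) * l] := by
      intro t
      have hbm : HasDerivAt (fun t : ℝ => t * b) b t := by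
        simpa using (hasDerivAt_id t).mul_const b
      have hrm : HasDerivAt (fun t : ℝ => t * r) r t := by
        simpa using (hasDerivAt_id t).mul_const r
      have h10 := hrm.mul (hlm t).exp
      have h11 := (hrm.mul hbm).add (hlm t).neg.exp
      ext i j
      simp only [velocity, hcoe]
      fin_cases i <;> fin_cases j <;> simp
      · exact h10.deriv
      · refine h11.deriv.trans ?_
        simp only [Pi.neg_apply]
        ring
    rintro t ⟨ht0, ht1⟩
    have hexp : ∀ x : ℝ, |x| ≤ ε → Real.exp (t * x) ≤ 3 := by
      intro x hx
      refine (Real.exp_le_exp.mpr ?_).trans Real.exp_one_lt_three.le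
      have : x ≤ 1 := (le_abs_self x).trans (hx.trans hε1)
      nlinarith
    have hE := hexp l hl
    have hE' : Real.exp (-(t * l)) ≤ 3 := by
      have := hexp (-l) (by rwa [abs_neg])
      rwa [mul_neg] at this
    have hE0 := (Real.exp_pos (t * l)).le
    have hE0' := (Real.exp_pos (-(t * l))).le
    have htr : |t * r| ≤ ε := by
      rw [abs_mul, abs_of_nonneg ht0]
      exact (mul_le_of_le_one_left (abs_nonneg r) ht1).trans hr
    have htb : |t * b| ≤ ε := by
      rw [abs_mul, abs_of_nonneg ht0]
      exact (mul_le_of_le_one_left (abs_nonneg b) ht1).trans hb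
    have hv : ∀ i j, |velocity c t i j| ≤ 6 * ε := by
      intro i j
      rw [hder]
      have hlE : |Real.exp (t * l) * l| ≤ 3 * ε := by
        rw [abs_mul, abs_of_nonneg hE0]; gcongr
      have hlE' : |Real.exp (-(t * l)) * l| ≤ 3 * ε := by
        rw [abs_mul, abs_of_nonneg hE0']; gcongr
      fin_cases i <;> fin_cases j <;> simp only [Fin.mk_zero, Fin.mk_one, Matrix.of_apply,
        Matrix.cons_val_zero, Matrix.cons_val_one, Matrix.cons_val', Fin.isValue,
        Matrix.cons_val_fin_one]
      · linarith
      · linarith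
      · have h1 : |r * Real.exp (t * l)| ≤ ε * 3 := by
          rw [abs_mul, abs_of_nonneg hE0]; gcongr
        have h2 : |t * r * (Real.exp (t * l) * l)| ≤ 1 * (3 * ε) := by
          rw [abs_mul]; gcongr; exact htr.trans hε1
        exact (abs_add_le _ _).trans (by linarith)
      · have h1 : |2 * (t * r * b)| ≤ 2 * (1 * ε) := by
          rw [abs_mul, abs_mul, abs_two]; gcongr; exact htr.trans hε1
        exact (abs_sub _ _).trans (by linarith)
    have hinv : ∀ i j, |((c t)⁻¹ : SL(2, ℝ)) i j| ≤ 4 := by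
      intro i j
      rw [Matrix.SpecialLinearGroup.coe_inv, Matrix.adjugate_fin_two, hcoe]
      have h2 : |t * r * Real.exp (t * l)| ≤ 1 * 3 := by
        rw [abs_mul, abs_of_nonneg hE0]; gcongr; exact htr.trans hε1
      have h3 : |t * r * (t * b)| ≤ 1 * 1 := by
        rw [abs_mul]; gcongr
        · exact htr.trans hε1
        · exact htb.trans hε1
      fin_cases i <;> fin_cases j <;> simp only [Fin.mk_zero, Fin.mk_one, Matrix.of_apply,
        Matrix.cons_val_zero, Matrix.cons_val_one, Matrix.cons_val', Fin.isValue,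
        Matrix.cons_val_fin_one, abs_neg]
      · refine (abs_add_le _ _).trans ?_
        rw [abs_of_nonneg hE0']
        linarith
      · linarith
      · linarith
      · rw [abs_of_nonneg hE0]; linarith
    intro i j
    rw [leftVelocity, Matrix.mul_apply, Fin.sum_univ_two]
    refine (abs_add_le _ _).trans ?_
    rw [abs_mul, abs_mul]
    calc _ ≤ 4 * (6 * ε) + 4 * (6 * ε) := by
          gcongr <;> first | exact hinv _ _ | exact hv _ _
      _ = 48 * ε := by ring
  have hlen : curveLength B c < η := by
    have h1 : ∀ t ∈ Set.uIoc (0 : ℝ) 1,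
        ‖Real.sqrt (B (leftVelocity c t) (leftVelocity c t))‖ ≤ Real.sqrt K * (48 * ε) := by
      intro t ht
      rw [Set.uIoc_of_le zero_le_one] at ht
      rw [Real.norm_of_nonneg (Real.sqrt_nonneg _), Real.sqrt_le_left (by positivity), mul_pow,
        Real.sq_sqrt hK0]
      exact hK _ _ (hbound t ⟨ht.1.le, ht.2⟩)
    have h2 := intervalIntegral.norm_integral_le_of_norm_le_const h1
    have h3 : curveLength B c ≤ Real.sqrt K * (48 * ε) := by
      unfold curveLength
      simpa using (le_abs_self _).trans h2
    have h4 : 0 < ε := by positivity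
    have := Real.sqrt_nonneg K
    nlinarith
  have := riemDist_le_curveLength B c hsmooth
  rw [hc0, hc1] at this
  exact this.trans_lt hlen

theorem conj_entries (l b s l' b' : ℝ) (m : ℤ) :
    ((a ^ (-m) * ((upperMat l b)⁻¹ * lowerMat s * upperMat l' b') * a ^ m : SL(2, ℝ)) :
      Matrix (Fin 2) (Fin 2) ℝ) =
    !![Real.exp (l' - l) - b * s * Real.exp l',
      Real.exp (-m) * (Real.exp (-l) * b' - b * (s * b' + Real.exp (-l')));
      Real.exp m * s * (Real.exp l * Real.exp l'),
      Real.exp (l - l') + Real.exp l * s * b'] := by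
  have h1 : Real.exp (m : ℝ) = Real.exp ((m : ℝ) / 2) * Real.exp ((m : ℝ) / 2) := by
    rw [← Real.exp_add]; congr 1; ring
  have h2 : Real.exp (-(m : ℝ)) = Real.exp (-((m : ℝ) / 2)) * Real.exp (-((m : ℝ) / 2)) := by
    rw [← Real.exp_add]; congr 1; ring
  have h3 : Real.exp (-((m : ℝ) / 2)) * Real.exp ((m : ℝ) / 2) = 1 := by
    rw [← Real.exp_add]; simp
  have h5 : Real.exp (l' - l) = Real.exp l' * Real.exp (-l) := by
    rw [← Real.exp_add]; congr 1
  have h6 : Real.exp (l - l') = Real.exp l * Real.exp (-l') := by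
    rw [← Real.exp_add]; congr 1
  rw [h1, h2, h5, h6]
  ext i j
  simp only [mul_apply_two, coe_a_zpow, Matrix.SpecialLinearGroup.coe_inv,
    Matrix.adjugate_fin_two]
  fin_cases i <;> fin_cases j <;> simp [lowerMat, upperMat, neg_div]
  · linear_combination (Real.exp (-l) * Real.exp l' - b * s * Real.exp l') * h3
  · ring
  · ring
  · linear_combination (Real.exp l * (s * b' + Real.exp (-l'))) * h3

/-- Under the flow, a displacement stays near the identity as long as its expanded part does. -/
theorem exists_conj_near_one {ε : ℝ} (hε : 0 < ε) :
    ∃ δ : ℝ, 0 < δ ∧ ∀ (l b s l' b' : ℝ) (m : ℤ), |l| ≤ δ → |b| ≤ δ → |l'| ≤ δ → |b'| ≤ δ →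
      0 ≤ m → Real.exp m * |s| ≤ δ → ∀ i j,
        |(a ^ (-m) * ((upperMat l b)⁻¹ * lowerMat s * upperMat l' b') * a ^ m : SL(2, ℝ)) i j -
          (1 : SL(2, ℝ)) i j| ≤ ε := by
  refine ⟨min (1 / 2) (ε / 9), by positivity, fun l b s l' b' m hl hb hl' hb' hm hs => ?_⟩
  set δ := min (1 / 2) (ε / 9)
  have hδ0 : 0 ≤ δ := (abs_nonneg _).trans hl
  have hδ1 : δ ≤ 1 / 2 := min_le_left _ _
  have hδ2 : 9 * δ ≤ ε := by
    have : δ ≤ ε / 9 := min_le_right _ _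
    linarith
  have hexp : ∀ x : ℝ, |x| ≤ δ → |Real.exp x| ≤ 3 := by
    intro x hx
    rw [abs_of_pos (Real.exp_pos _)]
    refine (Real.exp_le_exp.mpr ?_).trans Real.exp_one_lt_three.le
    linarith [le_abs_self x]
  have hexp1 : ∀ x y : ℝ, |x| ≤ δ → |y| ≤ δ → |Real.exp (x - y) - 1| ≤ 4 * δ := by
    intro x y hx hy
    have h1 : |x - y| ≤ 2 * δ := (abs_sub x y).trans (by linarith)
    have := Real.abs_exp_sub_one_le (x := x - y) (by linarith)
    linarith
  have hm' : (0 : ℝ) ≤ m := by exact_mod_cast hm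
  have hem : 1 ≤ Real.exp m := Real.one_le_exp hm'
  have hem' : |Real.exp (-(m : ℝ))| ≤ 1 := by
    rw [abs_of_pos (Real.exp_pos _), Real.exp_le_one_iff]; linarith
  have hs' : |s| ≤ δ := le_trans (le_mul_of_one_le_left (abs_nonneg s) hem) hs
  have hes : |Real.exp m * s| ≤ δ := by rwa [abs_mul, abs_of_pos (Real.exp_pos _)]
  have hlneg : |-l| ≤ δ := by rwa [abs_neg]
  have hlneg' : |-l'| ≤ δ := by rwa [abs_neg]
  have el := hexp l hl
  have el' := hexp l' hl'
  have enl := hexp _ hlneg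
  have enl' := hexp _ hlneg'
  intro i j
  rw [conj_entries]
  refine le_trans ?_ hδ2
  fin_cases i <;> fin_cases j <;> simp
  · have h1 := hexp1 l' l hl' hl
    have h2 : |b * s * Real.exp l'| ≤ δ * δ * 3 := by
      rw [abs_mul, abs_mul]; gcongr
    calc |Real.exp (l' - l) - b * s * Real.exp l' - 1|
        = |(Real.exp (l' - l) - 1) - b * s * Real.exp l'| := by ring_nf
      _ ≤ 4 * δ + δ * δ * 3 := (abs_sub _ _).trans (by linarith)
      _ ≤ 9 * δ := by nlinarith
  · have h1 : |s * b' + Real.exp (-l')| ≤ δ * δ + 3 := by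
      refine (abs_add_le _ _).trans ?_
      rw [abs_mul]; gcongr
    have h2 : |Real.exp (-l) * b' - b * (s * b' + Real.exp (-l'))| ≤ 3 * δ + δ * (δ * δ + 3) := by
      refine (abs_sub _ _).trans ?_
      rw [abs_mul, abs_mul]; gcongr
    calc _ ≤ 1 * (3 * δ + δ * (δ * δ + 3)) := by
          rw [← abs_of_pos (Real.exp_pos (-(m : ℝ))), ← abs_mul, abs_mul]
          gcongr
      _ ≤ 9 * δ := by nlinarith
  · calc _ ≤ δ * (3 * 3) := by
          rw [abs_of_pos (Real.exp_pos _)] at el el'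
          rw [← abs_of_pos (Real.exp_pos (m : ℝ)), ← abs_mul]
          gcongr
      _ ≤ 9 * δ := by linarith
  · have h1 := hexp1 l l' hl hl'
    have h2 : |Real.exp l * s * b'| ≤ 3 * δ * δ := by
      rw [abs_mul, abs_mul]; gcongr
    calc |Real.exp (l - l') + Real.exp l * s * b' - 1|
        = |(Real.exp (l - l') - 1) + Real.exp l * s * b'| := by ring_nf
      _ ≤ 4 * δ + 3 * δ * δ := (abs_add_le _ _).trans (by linarith)
      _ ≤ 9 * δ := by nlinarith

theorem exists_near_one_mem_groupBall (B : LinearMap.BilinForm ℝ (Matrix (Fin 2) (Fin 2) ℝ))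
    {η : ℝ} (hη : 0 < η) :
    ∃ ε : ℝ, 0 < ε ∧ ∀ k : SL(2, ℝ), (∀ i j, |k i j - (1 : SL(2, ℝ)) i j| ≤ ε) →
      k ∈ groupBall B η := by
  obtain ⟨ε₁, hε₁, h1⟩ := exists_lowerMat_mul_upperMat_mem_groupBall B hη
  obtain ⟨ε, hε, h2⟩ := exists_eq_lowerMat_mul_upperMat hε₁
  refine ⟨ε, hε, fun k hk => ?_⟩
  obtain ⟨r, l, b, hr, hl, hb, rfl⟩ := h2 k hk
  exact h1 r l b hr hl hb

theorem lowerMat_mul_lowerMat (r s : ℝ) : lowerMat r * lowerMat s = lowerMat (r + s) := by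
  ext i j
  rw [mul_apply_two]
  fin_cases i <;> fin_cases j <;> simp [lowerMat]

/-- Two points whose expanded coordinates at time `-N` differ by at most `δ e^{-2N}` lie in a
common Bowen `N`-ball. -/
theorem exists_mem_bowenBall (B : LinearMap.BilinForm ℝ (Matrix (Fin 2) (Fin 2) ℝ))
    {η : ℝ} (hη : 0 < η) :
    ∃ δ : ℝ, 0 < δ ∧ ∀ (N : ℕ) (g : SL(2, ℝ)) (r l b r' l' b' : ℝ), |l| ≤ δ → |b| ≤ δ →
      |l'| ≤ δ → |b'| ≤ δ → |r - r'| ≤ δ * Real.exp (-(2 * N)) →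
      X.mk (g * lowerMat r * upperMat l b * a ^ (N : ℤ)) ∈
        bowenBall B η N (X.mk (g * lowerMat r' * upperMat l' b' * a ^ (N : ℤ))) := by
  obtain ⟨ε, hε, hball⟩ := exists_near_one_mem_groupBall B hη
  obtain ⟨δ, hδ, hconj⟩ := exists_conj_near_one hε
  refine ⟨δ, hδ, fun N g r l b r' l' b' hl hb hl' hb' hr => ?_⟩
  set k := (upperMat l' b')⁻¹ * lowerMat (r - r') * upperMat l b with hk
  refine ⟨a ^ (-(N : ℤ)) * k * a ^ (N : ℤ), ?_, ?_⟩
  · refine Set.mem_iInter₂.mpr fun n hn => ?_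
    refine ⟨a ^ (-(N - n)) * k * a ^ (N - n), hball _ ?_, ?_⟩
    · refine hconj l' b' (r - r') l b (N - n) hl' hb' hl hb (by linarith [hn.2]) ?_
      have h1 : Real.exp ((N - n : ℤ) : ℝ) ≤ Real.exp (2 * N) := by
        have : (-(N : ℤ) : ℝ) ≤ n := by exact_mod_cast hn.1
        apply Real.exp_le_exp.mpr
        push_cast at this ⊢
        linarith
      calc Real.exp ((N - n : ℤ) : ℝ) * |r - r'|
          ≤ Real.exp (2 * N) * (δ * Real.exp (-(2 * N))) := by gcongr
        _ = δ := by
          rw [mul_left_comm, ← Real.exp_add]; simp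
    · show a ^ (-n) * (a ^ (-(N - n)) * k * a ^ (N - n)) * a ^ n = _
      have h1 : a ^ (-(N : ℤ)) = a ^ (-n) * a ^ (-(N - n)) := by rw [← zpow_add]; congr 1; ring
      have h2 : a ^ (N : ℤ) = a ^ ((N : ℤ) - n) * a ^ n := by rw [← zpow_add]; congr 1; ring
      rw [h1, h2]
      group
  · show X.rmul _ _ = _
    rw [X.rmul_mk, hk]
    have h1 : lowerMat r = lowerMat r' * lowerMat (r - r') := by
      rw [lowerMat_mul_lowerMat]; congr 1; ring
    rw [h1]
    congr 1
    group

theorem neg_notMem_and_notMem_of_mem_Z {M : ℝ} {N : ℕ} {V : Finset ℤ} {x : X}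
    (hx : x ∈ Z M N V) : -(N : ℤ) ∉ V ∧ (N : ℤ) ∉ V ∧ ht ((T ^ (-(N : ℤ))) x) < M := by
  obtain ⟨⟨⟨y, hy, hyx⟩, ⟨z, hz, hzx⟩⟩, hV⟩ := hx
  have hy' : (T ^ (-(N : ℤ))) x = y := by
    rw [← hyx, ← Equiv.Perm.mul_apply, ← zpow_add]; simp
  have hz' : (T ^ (N : ℤ)) x = z := by
    rw [← hzx, ← Equiv.Perm.mul_apply, ← zpow_add]; simp
  refine ⟨fun h => ?_, fun h => ?_, by rw [hy']; exact hy⟩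
  · have h1 : M ≤ _ := (hV _ ⟨le_rfl, by omega⟩).mpr h
    rw [hy'] at h1
    exact absurd hy (not_lt.mpr h1)
  · have h1 : M ≤ _ := (hV _ ⟨by omega, le_rfl⟩).mpr h
    rw [hz'] at h1
    exact absurd hz (not_lt.mpr h1)

/-- In terms of a representative at time `-N`, the set `Z(V)` prescribes a pattern of short
vectors on `[0, 2N]`. -/
theorem hasPattern_of_mem_Z {M : ℝ} (hM : 0 < M) {N : ℕ} {V : Finset ℤ} {x : X}
    (hx : x ∈ Z M N V) {g : SL(2, ℝ)} (hg : (T ^ (-(N : ℤ))) x = X.mk g) :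
    HasPattern M g 0 (2 * N) (V.map (addRightEmbedding (N : ℤ))) := by
  intro t ht
  rw [← le_ht_iff_isShortAt hM, ← hg, ← Equiv.Perm.mul_apply, ← zpow_add]
  refine (hx.2 (t + -N) ⟨by linarith [ht.1], by linarith [ht.2]⟩).trans ?_
  simp only [Finset.mem_map, addRightEmbedding_apply]
  constructor
  · exact fun h => ⟨_, h, by ring⟩
  · rintro ⟨s, hs, rfl⟩
    simpa using hs

/-- The covering of `Z(V)` by Bowen balls: finitely many charts cover the possible positions at
time `-N`, and in each chart a Bowen ball is placed over every interval given by
`exists_cover_of_pattern` that is met by `Z(V)`. -/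
theorem exists_cover_Z {M : ℝ} (hM : 9 ≤ M)
    (B : LinearMap.BilinForm ℝ (Matrix (Fin 2) (Fin 2) ℝ)) {η : ℝ} (hη : 0 < η) :
    ∃ C : ℝ, 0 < C ∧ ∀ (N : ℕ) (V : Finset ℤ), V ⊆ Finset.Icc (-(N : ℤ)) (N : ℤ) →
      ∃ S : Finset X, (S.card : ℝ) ≤ C * Real.exp (2 * (N : ℝ) - (V.card : ℝ) / 2) ∧
        Z M N V ⊆ ⋃ x ∈ S, bowenBall B η N x := by
  classical
  obtain ⟨δ, hδ, hbowen⟩ := exists_mem_bowenBall B hη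
  obtain ⟨G, hG⟩ := exists_finset_net (2 * M) (δ := min δ (1 / 20)) (by positivity)
  set κ := min 1 (δ / 2)
  have hκ : 0 < κ := by positivity
  have hκ1 : κ ≤ 1 := min_le_left _ _
  have hκ2 : κ ≤ δ / 2 := min_le_right _ _
  refine ⟨(G.card + 1) * (2 / κ * M ^ 2), by positivity, fun N V hVN => ?_⟩
  rcases (Z M N V).eq_empty_or_nonempty with hZ | ⟨x₀, hx₀⟩
  · exact ⟨∅, by simp; positivity, by simp [hZ]⟩
  obtain ⟨hN1, hN2, -⟩ := neg_notMem_and_notMem_of_mem_Z hx₀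
  set V' := V.map (addRightEmbedding (N : ℤ)) with hV'
  have hV'mem : ∀ t ∈ V', 0 < t ∧ t < 2 * (N : ℤ) := by
    intro t ht
    obtain ⟨s, hs, rfl⟩ := Finset.mem_map.mp ht
    have h1 := Finset.mem_Icc.mp (hVN hs)
    have h2 : s ≠ -N := by rintro rfl; exact hN1 hs
    have h3 : s ≠ N := by rintro rfl; exact hN2 hs
    simp only [addRightEmbedding_apply]
    omega
  have hM2 : 1 ≤ M ^ 2 := by nlinarith
  have hcov := fun g : SL(2, ℝ) => exists_cover_of_pattern hM g hκ hκ1 (2 * N) V' 0 le_rfl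
    (by positivity) hV'mem 0 (M ^ 2)
    (le_trans (Real.exp_le_one_iff.mpr (by push_cast; linarith [(Nat.cast_nonneg N : (0:ℝ) ≤ N)]))
      hM2)
    (fun p hp => mul_le_of_le_one_right (by positivity) (Real.exp_le_one_iff.mpr (by
      have := (hV'mem p hp).1.le
      have : (0 : ℝ) ≤ p := by exact_mod_cast this
      linarith)))
  choose F hFcard hF using hcov
  -- the points of `Z(V)` whose expanded coordinate lies in a given small interval
  let Q : SL(2, ℝ) → ℝ → X → Prop := fun g c x => ∃ r l b : ℝ,
    |l| ≤ δ ∧ |b| ≤ δ ∧ |r - c| ≤ κ * Real.exp (-(2 * N)) ∧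
      x = X.mk (g * lowerMat r * upperMat l b * a ^ (N : ℤ))
  have hcenter : ∀ g c, ∃ x' : X, ∀ x, Q g c x → Q g c x' := by
    intro g c
    by_cases h : ∃ x, Q g c x
    · obtain ⟨x', hx'⟩ := h
      exact ⟨x', fun _ _ => hx'⟩
    · exact ⟨X.mk 1, fun x hx => absurd ⟨x, hx⟩ h⟩
  choose center hcenter using hcenter
  refine ⟨G.biUnion fun g => (F g).image (center g), ?_, ?_⟩
  · have h1 : ((G.biUnion fun g => (F g).image (center g)).card : ℝ) ≤
        ∑ g ∈ G, (((F g).image (center g)).card : ℝ) := by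
      exact_mod_cast Finset.card_biUnion_le
    have h2 : ∑ g ∈ G, (((F g).image (center g)).card : ℝ) ≤
        G.card • (2 / κ * M ^ 2 * Real.exp (2 * N) * Real.exp (-(V.card : ℝ) / 2)) := by
      refine Finset.sum_le_card_nsmul _ _ _ fun g _ => ?_
      have h3 := hFcard g
      rw [hV', Finset.card_map] at h3
      push_cast at h3
      refine le_trans ?_ h3
      exact_mod_cast Finset.card_image_le
    refine h1.trans (h2.trans ?_)
    have h4 : Real.exp (2 * (N : ℝ) - (V.card : ℝ) / 2) =
        Real.exp (2 * N) * Real.exp (-(V.card : ℝ) / 2) := by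
      rw [← Real.exp_add]; congr 1; ring
    rw [h4, nsmul_eq_mul]
    have h5 : 0 ≤ 2 / κ * M ^ 2 * Real.exp (2 * N) * Real.exp (-(V.card : ℝ) / 2) := by positivity
    linarith
  · intro x hx
    obtain ⟨-, -, hlow⟩ := neg_notMem_and_notMem_of_mem_Z hx
    obtain ⟨g, hg, hbound⟩ := exists_bounded_representative (by linarith) _ hlow
    obtain ⟨g₀, hg₀, r, l, b, hr, hl, hb, rfl⟩ := hG g hbound
    have hδ' : min δ (1 / 20) ≤ δ := min_le_left _ _
    have h20 : min δ (1 / 20) ≤ 1 / 20 := min_le_right _ _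
    obtain ⟨c, hc, hrc⟩ := hF g₀ r (by rw [sub_zero]; linarith)
      ⟨l, b, hl.trans h20, hb.trans h20, hasPattern_of_mem_Z (by linarith) hx hg⟩
    push_cast at hrc
    have hxmk : x = X.mk (g₀ * lowerMat r * upperMat l b * a ^ (N : ℤ)) := by
      rw [← T_zpow_mk, ← hg, ← Equiv.Perm.mul_apply, ← zpow_add]; simp
    obtain ⟨r', l', b', hl', hb', hr'c, hx'⟩ := hcenter g₀ c x
      ⟨r, l, b, hl.trans hδ', hb.trans hδ', hrc, hxmk⟩
    refine Set.mem_iUnion₂.mpr ⟨center g₀ c, Finset.mem_biUnion.mpr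
      ⟨g₀, hg₀, Finset.mem_image_of_mem _ hc⟩, ?_⟩
    rw [hx', hxmk]
    refine hbowen N g₀ r l b r' l' b' (hl.trans hδ') (hb.trans hδ') hl' hb' ?_
    calc |r - r'| ≤ |r - c| + |r' - c| := by
          rw [abs_sub_comm r' c]; exact abs_sub_le r c r'
      _ ≤ 2 * κ * Real.exp (-(2 * N)) := by linarith
      _ ≤ δ * Real.exp (-(2 * N)) := by gcongr; linarith

/-! ### Counting excursion patterns -/

/-- In a pattern that occurs, the end of a run and any later member are at least `4 log M`
apart. -/
theorem four_log_le_of_Z_nonempty {M : ℝ} (hM : 1 < M) {N : ℕ} {V : Finset ℤ}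
    (hVN : V ⊆ Finset.Icc (-(N : ℤ)) N) (hZ : (Z M N V).Nonempty) {q p : ℤ} (hq : q ∈ V)
    (hq1 : q + 1 ∉ V) (hp : p ∈ V) (hqp : q < p) : 4 * Real.log M ≤ p - q := by
  obtain ⟨x, hx⟩ := hZ
  obtain ⟨g, hg⟩ : ∃ g, (T ^ (-(N : ℤ))) x = X.mk g := by
    obtain ⟨g, hg⟩ := Quotient.exists_rep ((T ^ (-(N : ℤ))) x)
    exact ⟨g, hg.symm⟩
  have hpat := hasPattern_of_mem_Z (by linarith) hx hg
  have hmem : ∀ t, t ∈ Finset.Icc (-(N : ℤ)) N → (IsShortAt M g (t + N) ↔ t ∈ V) := by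
    intro t ht
    rw [Finset.mem_Icc] at ht
    rw [hpat (t + N) ⟨by omega, by omega⟩]
    simp
  have hqN := Finset.mem_Icc.mp (hVN hq)
  have hpN := Finset.mem_Icc.mp (hVN hp)
  have h := pow_four_le_exp_of_gap hM (g := g) (q := q + N) (p := p + N)
    ((hmem q (hVN hq)).mpr hq) (fun h => by
      rw [add_right_comm] at h
      exact hq1 ((hmem (q + 1) (Finset.mem_Icc.mpr ⟨by omega, by omega⟩)).mp h))
    ((hmem p (hVN hp)).mpr hp) (by omega)
  have h1 := Real.log_le_log (by positivity) h
  rw [Real.log_exp, Real.log_pow] at h1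
  push_cast at h1
  linarith

theorem card_le_of_int_separated {F : Finset ℤ} {N : ℕ} {d : ℝ} (hd : 0 < d)
    (hF : F ⊆ Finset.Icc (-(N : ℤ)) N) (hsep : ∀ s ∈ F, ∀ t ∈ F, s < t → d ≤ t - s) :
    (F.card : ℝ) ≤ 2 * N / d + 2 := by
  have h := (finite_and_ncard_le_of_separated (S := (fun t : ℤ => (t : ℝ)) '' F) (lo := -(N : ℝ))
    (hi := N) hd ?_ (by linarith [(Nat.cast_nonneg N : (0 : ℝ) ≤ N)]) ?_).2
  · rw [Set.ncard_image_of_injective _ Int.cast_injective, Set.ncard_coe_finset] at h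
    have h1 : (N : ℝ) - -N = 2 * N := by ring
    rwa [h1] at h
  · rintro _ ⟨t, ht, rfl⟩
    have := Finset.mem_Icc.mp (hF ht)
    constructor
    · show -(N : ℝ) ≤ (t : ℝ)
      exact_mod_cast this.1
    · show (t : ℝ) ≤ N
      exact_mod_cast this.2
  · rintro _ ⟨s, hs, rfl⟩ _ ⟨t, ht, rfl⟩ hst
    exact hsep s hs t ht (Int.cast_lt.mp hst)

/-- The starts of the runs of `V` together with the times directly after their ends, within
`[-N, N]`. -/
noncomputable def runBoundary (N : ℕ) (V : Finset ℤ) : Finset ℤ :=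
  (Finset.Icc (-(N : ℤ)) N).filter (fun t => t ∈ V ∧ t - 1 ∉ V) ∪
    (Finset.Icc (-(N : ℤ)) N).filter (fun t => t ∉ V ∧ t - 1 ∈ V)

theorem mem_runBoundary {N : ℕ} {V : Finset ℤ} {t : ℤ} (ht : t ∈ Finset.Icc (-(N : ℤ)) N) :
    t ∈ runBoundary N V ↔ ¬ (t ∈ V ↔ t - 1 ∈ V) := by
  simp only [runBoundary, Finset.mem_union, Finset.mem_filter, ht, true_and]
  tauto

theorem eq_of_runBoundary_eq {N : ℕ} {V W : Finset ℤ} (hV : V ⊆ Finset.Icc (-(N : ℤ)) N)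
    (hW : W ⊆ Finset.Icc (-(N : ℤ)) N) (hV0 : -(N : ℤ) ∉ V) (hW0 : -(N : ℤ) ∉ W)
    (h : runBoundary N V = runBoundary N W) : V = W := by
  have key : ∀ t : ℤ, -(N : ℤ) ≤ t → t ≤ N → (t ∈ V ↔ t ∈ W) := by
    intro t ht
    induction t, ht using Int.leInduction with
    | base => exact fun _ => iff_of_false hV0 hW0
    | succ t ht ih =>
      intro htN
      have ih := ih (by omega)
      have hmem : t + 1 ∈ Finset.Icc (-(N : ℤ)) N := Finset.mem_Icc.mpr ⟨by omega, htN⟩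
      have h1 := mem_runBoundary (V := V) hmem
      have h2 := mem_runBoundary (V := W) hmem
      rw [h, add_sub_cancel_right] at h1
      rw [add_sub_cancel_right] at h2
      tauto
  ext t
  by_cases ht : t ∈ Finset.Icc (-(N : ℤ)) N
  · exact key t (Finset.mem_Icc.mp ht).1 (Finset.mem_Icc.mp ht).2
  · exact iff_of_false (fun h => ht (hV h)) (fun h => ht (hW h))

/-- Between a member of `V` and a later non-member, some run of `V` ends. -/
theorem exists_run_end {V : Finset ℤ} {s t : ℤ} (hs : s ∈ V) (ht : t ∉ V) (hst : s ≤ t) :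
    ∃ q, s ≤ q ∧ q < t ∧ q ∈ V ∧ q + 1 ∉ V := by
  by_contra! hcon
  refine ht ?_
  suffices ∀ u, s ≤ u → u ≤ t → u ∈ V from this t hst le_rfl
  intro u hu
  induction u, hu using Int.leInduction with
  | base => exact fun _ => hs
  | succ u hu ih => exact fun hut => hcon u hu (by omega) (ih (by omega))

theorem card_runBoundary_le {M : ℝ} (hM : 1 < M) {N : ℕ} {V : Finset ℤ}
    (hVN : V ⊆ Finset.Icc (-(N : ℤ)) N) (hZ : (Z M N V).Nonempty) :
    ((runBoundary N V).card : ℝ) ≤ N / Real.log M + 4 := by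
  have hL : 0 < Real.log M := Real.log_pos hM
  have hgap := fun q p => four_log_le_of_Z_nonempty hM hVN hZ (q := q) (p := p)
  have h1 := card_le_of_int_separated (d := 4 * Real.log M) (by positivity)
    (Finset.filter_subset (fun t => t ∈ V ∧ t - 1 ∉ V) (Finset.Icc (-(N : ℤ)) N)) (by
      intro s hs t ht hst
      obtain ⟨-, hs1, -⟩ := Finset.mem_filter.mp hs
      obtain ⟨-, ht1, ht2⟩ := Finset.mem_filter.mp ht
      obtain ⟨q, hsq, hqt, hq, hq1⟩ := exists_run_end hs1 ht2 (by omega)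
      have := hgap q t hq hq1 ht1 (by omega)
      have : (s : ℝ) ≤ q := by exact_mod_cast hsq
      linarith)
  have h2 := card_le_of_int_separated (d := 4 * Real.log M) (by positivity)
    (Finset.filter_subset (fun t => t ∉ V ∧ t - 1 ∈ V) (Finset.Icc (-(N : ℤ)) N)) (by
      intro s hs t ht hst
      obtain ⟨-, hs1, hs2⟩ := Finset.mem_filter.mp hs
      obtain ⟨-, -, ht2⟩ := Finset.mem_filter.mp ht
      have := hgap (s - 1) (t - 1) hs2 (by rwa [sub_add_cancel]) ht2 (by omega)
      push_cast at this
      linarith)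
  have h3 : ((runBoundary N V).card : ℝ) ≤
      ((Finset.Icc (-(N : ℤ)) N).filter (fun t => t ∈ V ∧ t - 1 ∉ V)).card +
      ((Finset.Icc (-(N : ℤ)) N).filter (fun t => t ∉ V ∧ t - 1 ∈ V)).card := by
    exact_mod_cast Finset.card_union_le _ _
  have h4 : 2 * (N : ℝ) / (4 * Real.log M) = N / Real.log M / 2 := by field_simp; ring
  rw [h4] at h1 h2
  linarith

/-- A set with at most `k` elements has weight `z ^ card` at least `z ^ k`, and the weights of
all subsets of `[-N, N]` add up to `(1 + z) ^ (2 N + 1)`. The choice `z = 1 / (2 log M)` is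
close to optimal. -/
theorem ncard_patterns_le {M : ℝ} (hM : Real.exp 8 ≤ M) (N : ℕ) :
    (Set.ncard {V : Finset ℤ | V ⊆ Finset.Icc (-(N : ℤ)) (N : ℤ) ∧ (Z M N V).Nonempty} : ℝ) ≤
      Real.exp (1 / (2 * Real.log M) + 4 * Real.log (2 * Real.log M)) *
        Real.exp (2 * Real.log (Real.log M) / Real.log M * N) := by
  classical
  have hM1 : 1 < M := lt_of_lt_of_le (Real.one_lt_exp_iff.mpr (by norm_num)) hM
  set L := Real.log M with hL
  have hL8 : 8 ≤ L := by rw [hL, Real.le_log_iff_exp_le (by linarith)]; exact hM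
  set 𝒱 := {V : Finset ℤ | V ⊆ Finset.Icc (-(N : ℤ)) (N : ℤ) ∧ (Z M N V).Nonempty}
  have hfin : 𝒱.Finite :=
    (Finset.finite_toSet (Finset.Icc (-(N : ℤ)) (N : ℤ)).powerset).subset
      fun V hV => Finset.mem_coe.mpr (Finset.mem_powerset.mpr hV.1)
  have hinj : Set.InjOn (runBoundary N) (hfin.toFinset : Set (Finset ℤ)) := by
    intro V hV W hW h
    rw [Set.Finite.coe_toFinset] at hV hW
    obtain ⟨x, hx⟩ := hV.2
    obtain ⟨y, hy⟩ := hW.2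
    exact eq_of_runBoundary_eq hV.1 hW.1 (neg_notMem_and_notMem_of_mem_Z hx).1
      (neg_notMem_and_notMem_of_mem_Z hy).1 h
  set z := 1 / (2 * L) with hz
  have hz0 : 0 < z := by positivity
  have hz1 : z ≤ 1 := by rw [hz, div_le_one (by positivity)]; linarith
  have hsum : ∑ V ∈ hfin.toFinset, z ^ (runBoundary N V).card ≤ (1 + z) ^ (2 * N + 1) := by
    rw [← Finset.sum_image (f := fun D : Finset ℤ => z ^ D.card) hinj]
    have h1 : ∑ D ∈ (Finset.Icc (-(N : ℤ)) N).powerset, z ^ D.card = (1 + z) ^ (2 * N + 1) := by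
      have := Finset.prod_one_add (f := fun _ : ℤ => z) (Finset.Icc (-(N : ℤ)) N)
      simp only [Finset.prod_const, Int.card_Icc] at this
      rw [← this]
      congr 1
      omega
    rw [← h1]
    refine Finset.sum_le_sum_of_subset_of_nonneg ?_ fun _ _ _ => by positivity
    intro D hD
    obtain ⟨V, -, rfl⟩ := Finset.mem_image.mp hD
    exact Finset.mem_powerset.mpr
      (Finset.union_subset (Finset.filter_subset _ _) (Finset.filter_subset _ _))
  have hweight : ∀ V ∈ hfin.toFinset,
      Real.exp (-(N / L + 4) * Real.log (2 * L)) ≤ z ^ (runBoundary N V).card := by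
    intro V hV
    have hV' : V ∈ 𝒱 := (Set.Finite.mem_toFinset hfin).mp hV
    have hcard := card_runBoundary_le hM1 hV'.1 hV'.2
    rw [← Real.exp_log (pow_pos hz0 _), Real.log_pow, hz, one_div, Real.log_inv]
    apply Real.exp_le_exp.mpr
    have : 0 ≤ Real.log (2 * L) := Real.log_nonneg (by linarith)
    nlinarith
  have h1 : (hfin.toFinset.card : ℝ) * Real.exp (-(N / L + 4) * Real.log (2 * L)) ≤
      Real.exp (z * (2 * N + 1)) := by
    rw [← nsmul_eq_mul]
    refine (Finset.card_nsmul_le_sum _ _ _ hweight).trans (hsum.trans ?_)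
    have h2 : 1 + z ≤ Real.exp z := by linarith [Real.add_one_le_exp z]
    calc (1 + z) ^ (2 * N + 1) ≤ Real.exp z ^ (2 * N + 1) := by gcongr
      _ = _ := by rw [← Real.exp_nat_mul]; congr 1; push_cast; ring
  rw [Set.ncard_eq_toFinset_card _ hfin, ← Real.exp_add]
  have h2 : (hfin.toFinset.card : ℝ) ≤
      Real.exp (z * (2 * N + 1)) * Real.exp ((N / L + 4) * Real.log (2 * L)) := by
    have h3 : Real.exp (-(N / L + 4) * Real.log (2 * L)) *
        Real.exp ((N / L + 4) * Real.log (2 * L)) = 1 := by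
      rw [← Real.exp_add, ← add_mul, neg_add_cancel, zero_mul, Real.exp_zero]
    calc (hfin.toFinset.card : ℝ) = hfin.toFinset.card *
          Real.exp (-(N / L + 4) * Real.log (2 * L)) *
          Real.exp ((N / L + 4) * Real.log (2 * L)) := by rw [mul_assoc, h3, mul_one]
      _ ≤ _ := by gcongr
  refine h2.trans ?_
  rw [← Real.exp_add]
  apply Real.exp_le_exp.mpr
  -- the remaining inequality is `1 + log (2 L) ≤ 2 log L`, that is `2 e ≤ L`
  have hlog2 : Real.log (2 * L) = Real.log 2 + Real.log L :=
    Real.log_mul (by norm_num) (by linarith)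
  have hlogL : 1 + Real.log 2 ≤ Real.log L := by
    rw [Real.le_log_iff_exp_le (by linarith), Real.exp_add, Real.exp_log (by norm_num)]
    linarith [Real.exp_one_lt_three]
  have h4 : (N : ℝ) / L * (1 + Real.log (2 * L)) ≤ N / L * (2 * Real.log L) := by
    gcongr
    linarith
  have h5 : z * (2 * N + 1) = N / L + 1 / (2 * L) := by rw [hz]; field_simp
  have h6 : 2 * Real.log L / L * N = N / L * (2 * Real.log L) := by ring
  rw [h5, h6]
  linarith

end ModularFlow

theorem mainTheorem7 :
    ∃ M₀ : ℝ, 1 < M₀ ∧ ∀ M : ℝ, M₀ ≤ M →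
      (∀ B : LinearMap.BilinForm ℝ (Matrix (Fin 2) (Fin 2) ℝ),
        ModularFlow.IsInnerProductOnSl2 B → ∀ η : ℝ, 0 < η →
          ∃ C : ℝ, 0 < C ∧ ∀ N : ℕ, 1 ≤ N →
            ∀ V : Finset ℤ, V ⊆ Finset.Icc (-(N : ℤ)) (N : ℤ) →
              ∃ S : Finset ModularFlow.X,
                (S.card : ℝ) ≤ C * Real.exp (2 * (N : ℝ) - (V.card : ℝ) / 2) ∧
                ModularFlow.Z M N V ⊆ ⋃ x ∈ S, ModularFlow.bowenBall B η N x) ∧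
      (∃ C : ℝ, 0 < C ∧ ∀ N : ℕ, 1 ≤ N →
        (Set.ncard {V : Finset ℤ | V ⊆ Finset.Icc (-(N : ℤ)) (N : ℤ) ∧
            (ModularFlow.Z M N V).Nonempty} : ℝ) ≤
          C * Real.exp (2 * Real.log (Real.log M) / Real.log M * (N : ℝ))) := by
  refine ⟨Real.exp 8, Real.one_lt_exp_iff.mpr (by norm_num), fun M hM => ⟨?_, ?_⟩⟩
  · intro B _ η hη
    have h9 : 9 ≤ M := by linarith [Real.add_one_le_exp (8 : ℝ)]
    obtain ⟨C, hC, h⟩ := ModularFlow.exists_cover_Z h9 B hη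
    exact ⟨C, hC, fun N _ V hV => h N V hV⟩
  · exact ⟨_, Real.exp_pos _, fun N _ => ModularFlow.ncard_patterns_le hM N⟩
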